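/- Fix integers $K\ge r\ge 1$ (number of machines and computation load). For a graph $G=(\mathcal V,\mathcal E)$ with $|\mathcal V|=n$, $K\mid n$, an allocation $A\in\mathcal A(r)$ consists of sets $\mathcal M_k\subseteq\mathcal V$ with $|\mathcal M_k|=rn/K$ and $\bigcup_k\mathcal M_k=\mathcal V$ (vertices mapped by machine $k$), and a partition of $\mathcal V$ into sets $\mathcal R_k$ with $|\mathcal R_k|=n/K$ (vertices reduced by machine $k$), $k\in[K]$. To every ordered pair $(i,j)$ of adjacent vertices belongs an arbitrary intermediate value $v_{i,j}\in\{0,1\}^T$, $T\ge1$. A feasible shuffle scheme lets each machine $k$ multicast a message $X_k\in\{0,1\}^{c_k}$ that is a function of its local values $\{v_{i,j}: (i,j)\in\mathcal E, j\in\mathcal M_k\}$, such that each machine $k$ can, for all intermediate values, recover $\{v_{i,j}:(i,j)\in\mathcal E, i\in\mathcal R_k, j\notin\mathcal M_k\}$ from its local values and the messages of the other machines. Let $L_A(r,G)$ be the minimum of $\frac{1}{n^2T}\sum_k c_k$ over all feasible schemes for $G$ and $A$, and for a random graph $\mathcal G$ let $L^*(r)=\inf_{A\in\mathcal A(r)}\mathbb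 E_{\mathcal G}[L_A(r,\mathcal G)]$. Let $\mathcal G$ be the random bipartite graph $\mathrm{RB}(n_1,n_2,q)$, which has two disjoint clusters of sizes $n_1,n_2$, no edges inside a cluster, and each edge between the clusters independently with probability $q\in(0,1]$. Let $n=n_1+n_2\to\infty$ through multiples of $K$, with $n_1=\Theta(n)$, $n_2=\Theta(n)$, $|n_1-n_2|=o(n)$ and $q=\omega(1/n^2)$, where $n_1,n_2,q$ and $T\ge 1$ may vary along the sequence and $K,r$ are fixed. Then $$\frac{1}{8r}\Big(1-\frac{2r}{K}\Big)\le\limsup_{n\to\infty}\frac{L^*(r)}{q},$$ and, if $K$ is even and $2r\le K$, $$\limsup_{n\to\infty}\frac{L^*(r)}{q}\le\frac{1}{2r}\Big(1-\frac{2r}{K}\Big).$$ -/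

import Mathlib

open Filter Asymptotics MeasureTheory ProbabilityTheory

/-- Binary strings of length `T`. -/
abbrev Bits (T : ℕ) : Type := Fin T → Bool

/-- Subgraph and computation allocations over the vertex set `V` for `K` machines with computation
load `r`: every vertex is mapped by at least one machine, every machine maps exactly `r * |V| / K`
vertices, and the reducers are partitioned into `K` parts of exactly `|V| / K` vertices. -/
structure Allocation (V : Type*) [Fintype V] (K r : ℕ) where
  /-- `M k` is the set of vertices mapped by machine `k`. -/
  M : Fin K → Finset V
  /-- `R k` is the set of vertices reduced by machine `k`. -/
  R : Fin K → Finset V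
  map_cover : ∀ v, ∃ k, v ∈ M k
  map_card : ∀ k, K * (M k).card = r * Fintype.card V
  reduce_cover : ∀ v, ∃ k, v ∈ R k
  reduce_disjoint : ∀ k l, k ≠ l → Disjoint (R k) (R l)
  reduce_card : ∀ k, K * (R k).card = Fintype.card V

section Shuffle

variable {V : Type*} [Fintype V] {K r : ℕ}

/-- Index set of the intermediate values: the pair `(i, j)` stands for the value `v_{i,j}` that the
reducer of `i` needs from the file of its neighbor `j`. -/
abbrev Present (G : SimpleGraph V) : Type _ := {p : V × V // G.Adj p.1 p.2}

/-- Indices of the intermediate values computed by machine `k` in the Map phase. -/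
abbrev Known (G : SimpleGraph V) (A : Allocation V K r) (k : Fin K) : Type _ :=
  {p : Present G // p.1.2 ∈ A.M k}

/-- Indices of the intermediate values that machine `k` has to recover in the Shuffle phase. -/
abbrev Needed (G : SimpleGraph V) (A : Allocation V K r) (k : Fin K) : Type _ :=
  {p : Present G // p.1.1 ∈ A.R k ∧ p.1.2 ∉ A.M k}

/-- A feasible Shuffle coding scheme for the graph `G`, the allocation `A` and intermediate values
of `T` bits: machine `k` multicasts `c k` bits that are a function of its local values, and
recovers the values it needs from its local values and the messages of the other machines, whatever
the intermediate values are. -/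
structure ShuffleScheme (G : SimpleGraph V) (A : Allocation V K r) (T : ℕ) where
  /-- Length of the message of machine `k`. -/
  c : Fin K → ℕ
  encode : ∀ k, (Known G A k → Bits T) → Bits (c k)
  decode : ∀ k, (Known G A k → Bits T) → (∀ l : {l : Fin K // l ≠ k}, Bits (c l)) →
    (Needed G A k → Bits T)
  correct : ∀ (v : Present G → Bits T) (k : Fin K),
    decode k (fun p => v p.1) (fun l => encode l (fun p => v p.1)) = fun p => v p.1

/-- The minimum total number of bits multicast by a feasible Shuffle coding scheme. -/
noncomputable def minBits (G : SimpleGraph V) (A : Allocation V K r) (T : ℕ) : ℕ :=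
  sInf {b | ∃ S : ShuffleScheme G A T, ∑ k, S.c k = b}

/-- The minimum communication load of the allocation `A` on `G`, normalized by `|V|² T`. -/
noncomputable def commLoad (G : SimpleGraph V) (A : Allocation V K r) (T : ℕ) : ℝ :=
  (minBits G A T : ℝ) / ((Fintype.card V : ℝ) ^ 2 * T)

end Shuffle

/-- The bipartite graph with clusters `Fin n₁`, `Fin n₂` and set of cross edges `E`. -/
def bipartiteGraph {n₁ n₂ : ℕ} (E : Set (Fin n₁ × Fin n₂)) : SimpleGraph (Fin n₁ ⊕ Fin n₂) where
  Adj x y := ∃ e ∈ E, (x = Sum.inl e.1 ∧ y = Sum.inr e.2) ∨ (x = Sum.inr e.2 ∧ y = Sum.inl e.1)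
  symm := ⟨by
    rintro x y ⟨e, he, h | h⟩
    · exact ⟨e, he, Or.inr ⟨h.2, h.1⟩⟩
    · exact ⟨e, he, Or.inl ⟨h.2, h.1⟩⟩⟩
  loopless := ⟨by
    rintro x ⟨e, -, ⟨h, h'⟩ | ⟨h, h'⟩⟩
    · exact Sum.inl_ne_inr (h.symm.trans h')
    · exact Sum.inr_ne_inl (h.symm.trans h')⟩

/-- The optimal average communication load `L*(r)` of the random bipartite model
`RB(n₁, n₂, q)`: every cross edge is present independently with probability `q`, and the allocation
is chosen before the graph is drawn. -/
noncomputable def optimalLoad (n₁ n₂ K r T : ℕ) (q : unitInterval) : ℝ :=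
  ⨅ A : Allocation (Fin n₁ ⊕ Fin n₂) K r,
    ∫ E : Set (Fin n₁ × Fin n₂), commLoad (bipartiteGraph E) A T ∂(setBernoulli Set.univ q)

/-!
Converse. Let `S` be a set of machines and fix all values except those of the pairs `(i, j)` with
the reducer of `i` in `S` and `j` mapped by no machine of `S`. The machines of `S` then send fixed
messages, and they recover the remaining values from the messages of the other machines, which must
therefore carry at least as many bits. Averaging over a random `S` that contains each machine
independently with probability `1 / (2 * r)`, the contribution of a vertex `j` with `m` mappers is
bounded below by a multiple of `(1 - m / (2 * r)) * (1 - 2 * m / K)`; replacing this by its tangent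
at the mean `r` of `m` gives the factor `1 / (8 * r)`.

Achievability. Recolour `|n₁ - n₂| / 2` vertices so that both colours have `n / 2` vertices, and
split the machines into two halves, each of which reduces one colour and maps the other, in batches
indexed by its `r`-subsets. Within a group of `r + 1` machines of one half, the values that one
machine lacks and the other `r` know are cut into `r` pieces, and each machine sends the exclusive
or of the pieces it is responsible for, which divides the load by `r`. Values involving recoloured
or leftover vertices are sent uncoded; they are negligible since `|n₁ - n₂| = o(n)`. The message
length of a group is governed by its largest count, which exceeds the mean by a multiple of
`√variance = O(n √q)` on average, and this is `o(n² q)` because `q = ω(1 / n²)`.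
-/

section Coding

variable {V : Type*} [Fintype V] {K r : ℕ}

namespace Allocation

/-- The machine that reduces the vertex `v`. -/
noncomputable def reducer (A : Allocation V K r) (v : V) : Fin K := (A.reduce_cover v).choose

theorem mem_R_iff (A : Allocation V K r) {v : V} {k : Fin K} : v ∈ A.R k ↔ A.reducer v = k := by
  have h : v ∈ A.R (A.reducer v) := (A.reduce_cover v).choose_spec
  refine ⟨fun hk => ?_, fun hk => hk ▸ h⟩
  by_contra hne
  exact Finset.disjoint_left.1 (A.reduce_disjoint _ _ hne) h hk

open scoped Classical in
/-- The machines that map the vertex `v`. -/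
noncomputable def mappers (A : Allocation V K r) (v : V) : Finset (Fin K) := {k | v ∈ A.M k}

@[simp]
theorem mem_mappers {A : Allocation V K r} {v : V} {k : Fin K} :
    k ∈ A.mappers v ↔ v ∈ A.M k := by
  simp [mappers]

open scoped Classical in
/-- The pairs `(i, j)` of adjacent vertices such that the reducer of `i` does not map `j`, so that
it has to recover the value `v_{i,j}` in the Shuffle phase. -/
noncomputable def missing (A : Allocation V K r) (G : SimpleGraph V) : Finset (V × V) :=
  {p | G.Adj p.1 p.2 ∧ A.reducer p.1 ∉ A.mappers p.2}

theorem mem_missing {A : Allocation V K r} {G : SimpleGraph V} {p : V × V} :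
    p ∈ A.missing G ↔ G.Adj p.1 p.2 ∧ A.reducer p.1 ∉ A.mappers p.2 := by
  simp [missing]

end Allocation

namespace ShuffleScheme

variable {G : SimpleGraph V} {A : Allocation V K r} {T : ℕ}

theorem eq_of_encode_eq (S : ShuffleScheme G A T) {v v' : Present G → Bits T} {k : Fin K}
    (hlocal : ∀ p : Known G A k, v p.1 = v' p.1)
    (hmsg : ∀ l, S.encode l (fun p => v p.1) = S.encode l (fun p => v' p.1))
    (p : Needed G A k) : v p.1 = v' p.1 := by
  have h := S.correct v k
  simp only [hlocal, hmsg] at h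
  exact (congrFun h p).symm.trans (congrFun (S.correct v' k) p)

theorem exists_of_determined {ι : Fin K → Type*} [∀ k, Fintype (ι k)]
    (encode : ∀ k, (Known G A k → Bits T) → ι k → Bool)
    (determined : ∀ (v v' : Present G → Bits T) (k : Fin K),
      (∀ p : Known G A k, v p.1 = v' p.1) →
      (∀ l ≠ k, encode l (fun p => v p.1) = encode l (fun p => v' p.1)) →
      ∀ p : Needed G A k, v p.1 = v' p.1) :
    ∃ S : ShuffleScheme G A T, ∀ k, S.c k = Fintype.card (ι k) := by
  classical
  let message (k : Fin K) (loc : Known G A k → Bits T) : Bits (Fintype.card (ι k)) :=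
    fun i => encode k loc ((Fintype.equivFin (ι k)).symm i)
  let Consistent (k : Fin K) (loc : Known G A k → Bits T)
      (msg : ∀ l : {l : Fin K // l ≠ k}, Bits (Fintype.card (ι l))) (v : Present G → Bits T) :=
    (∀ p, v p.1 = loc p) ∧ ∀ l : {l : Fin K // l ≠ k}, message l (fun p => v p.1) = msg l
  refine ⟨⟨fun k => Fintype.card (ι k), message, fun k loc msg p =>
    if h : ∃ v, Consistent k loc msg v then h.choose p.1 else fun _ => false, ?_⟩, fun _ => rfl⟩
  intro v k
  funext p
  have hv : ∃ v', Consistent k (fun p => v p.1) (fun l => message l fun p => v p.1) v' :=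
    ⟨v, fun _ => rfl, fun _ => rfl⟩
  rw [dif_pos hv]
  refine determined _ v k hv.choose_spec.1 (fun l hl => funext fun i => ?_) p
  simpa [message] using congrFun (hv.choose_spec.2 ⟨l, hl⟩) (Fintype.equivFin (ι l) i)

end ShuffleScheme

variable (G : SimpleGraph V) (A : Allocation V K r) (T : ℕ)

/-- The bit `b.2` of the value of the pair `b.1`, with value `false` if this pair is not adjacent
or not known to machine `k`. -/
noncomputable def localBit {G : SimpleGraph V} {A : Allocation V K r} {T : ℕ} (k : Fin K)
    (loc : Known G A k → Bits T) (b : (V × V) × Fin T) : Bool :=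
  open scoped Classical in
  if h : ∃ _ : G.Adj b.1.1 b.1.2, b.1.2 ∈ A.M k then loc ⟨⟨b.1, h.1⟩, h.2⟩ b.2 else false

open scoped Classical in
/-- Every slot carries the sum in `Bool` (exclusive or) of the missing bits assigned to it. -/
theorem ShuffleScheme.exists_of_slots {σ : Type*} (slots : Finset σ) (sender : σ → Fin K)
    (slot : (V × V) × Fin T → σ)
    (hslot : ∀ b : (V × V) × Fin T, b.1 ∈ A.missing G → slot b ∈ slots)
    (hsender : ∀ b : (V × V) × Fin T, b.1 ∈ A.missing G → sender (slot b) ∈ A.mappers b.1.2)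
    (hdecode : ∀ b b' : (V × V) × Fin T, b.1 ∈ A.missing G → b'.1 ∈ A.missing G → b ≠ b' →
      slot b = slot b' → A.reducer b.1.1 ∈ A.mappers b'.1.2) :
    ∃ S : ShuffleScheme G A T, ∑ k, S.c k = slots.card := by
  let bits (s : σ) : Finset ((V × V) × Fin T) := {b | b.1 ∈ A.missing G ∧ slot b = s}
  refine (ShuffleScheme.exists_of_determined (ι := fun k => {s // s ∈ slots.filter (sender · = k)})
    (fun k loc s => ∑ b ∈ bits s, localBit k loc b) ?_).imp fun S hS => ?_
  swap
  · simp only [hS, Fintype.card_coe]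
    exact (Finset.card_eq_sum_card_fiberwise fun s _ => Finset.mem_univ (sender s)).symm
  intro v v' k hlocal hmsg p
  funext t
  let b : (V × V) × Fin T := (p.1.1, t)
  have hk : A.reducer b.1.1 = k := A.mem_R_iff.1 p.2.1
  have hb : b.1 ∈ A.missing G :=
    Allocation.mem_missing.2 ⟨p.1.2, by simpa [hk] using p.2.2⟩
  have hbs : b ∈ bits (slot b) := by simp [bits, hb]
  have hmap : b.1.2 ∈ A.M (sender (slot b)) := Allocation.mem_mappers.1 (hsender b hb)
  have hne : sender (slot b) ≠ k := by
    intro h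
    rw [h] at hmap
    exact p.2.2 hmap
  have hsum := congrFun (hmsg _ hne) ⟨slot b, by simp [hslot b hb]⟩
  have hother : ∀ b' ∈ (bits (slot b)).erase b,
      localBit _ (fun p : Known G A (sender (slot b)) => v p.1) b' =
        localBit _ (fun p : Known G A (sender (slot b)) => v' p.1) b' := by
    intro b' hb'
    obtain ⟨hne', hb', heq⟩ : b' ≠ b ∧ b'.1 ∈ A.missing G ∧ slot b' = slot b := by
      simpa [bits] using hb'
    have hknown := Allocation.mem_mappers.1 (hk ▸ hdecode b b' hb hb' hne'.symm heq.symm)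
    unfold localBit
    split_ifs with h
    · exact congrFun (hlocal ⟨⟨b'.1, h.1⟩, hknown⟩) b'.2
    · rfl
  rw [← Finset.add_sum_erase _ _ hbs, ← Finset.add_sum_erase _ _ hbs,
    Finset.sum_congr rfl hother, add_left_inj] at hsum
  simpa [localBit, hmap, p.1.2, b] using hsum

open scoped Classical in
theorem minBits_le_card_slots {σ : Type*} (slots : Finset σ) (sender : σ → Fin K)
    (slot : (V × V) × Fin T → σ)
    (hslot : ∀ b : (V × V) × Fin T, b.1 ∈ A.missing G → slot b ∈ slots)
    (hsender : ∀ b : (V × V) × Fin T, b.1 ∈ A.missing G → sender (slot b) ∈ A.mappers b.1.2)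
    (hdecode : ∀ b b' : (V × V) × Fin T, b.1 ∈ A.missing G → b'.1 ∈ A.missing G → b ≠ b' →
      slot b = slot b' → A.reducer b.1.1 ∈ A.mappers b'.1.2) :
    minBits G A T ≤ slots.card :=
  Nat.sInf_le (ShuffleScheme.exists_of_slots G A T slots sender slot hslot hsender hdecode)

theorem exists_shuffleScheme_eq_minBits :
    ∃ S : ShuffleScheme G A T, ∑ k, S.c k = minBits G A T :=
  Nat.sInf_mem (s := {b | ∃ S : ShuffleScheme G A T, ∑ k, S.c k = b})
    ⟨_, ShuffleScheme.exists_of_slots G A T Finset.univ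
      (fun b : (V × V) × Fin T => (A.map_cover b.1.2).choose) id (fun b _ => Finset.mem_univ b)
      (fun b _ => Allocation.mem_mappers.2 (A.map_cover b.1.2).choose_spec)
      (fun _ _ _ _ hne h => (hne h).elim)⟩

variable {G A T} in
open scoped Classical in
/-- Cut-set bound: once the values outside `Q` are fixed, the machines reducing the pairs of `Q`
know nothing about the values on `Q`, so these are determined by the messages alone. -/
theorem card_mul_le_minBits_of_cut (Q : Finset (V × V)) (hadj : ∀ p ∈ Q, G.Adj p.1 p.2)
    (hcut : ∀ p ∈ Q, ∀ p' ∈ Q, A.reducer p.1 ∉ A.mappers p'.2) :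
    Q.card * T ≤ minBits G A T := by
  obtain ⟨S, hS⟩ := exists_shuffleScheme_eq_minBits G A T
  let extend (u : Q → Bits T) (p : Present G) : Bits T :=
    if h : p.1 ∈ Q then u ⟨p.1, h⟩ else fun _ => false
  let messages (u : Q → Bits T) (k : Fin K) : Bits (S.c k) := S.encode k fun p => extend u p.1
  have hinj : Function.Injective messages := by
    intro u u' hu
    funext p
    have hlocal : ∀ p' : Known G A (A.reducer p.1.1), extend u p'.1 = extend u' p'.1 := by
      intro p'
      have hp' : p'.1.1 ∉ Q := fun h => hcut p p.2 _ h (Allocation.mem_mappers.2 p'.2)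
      simp only [extend, dif_neg hp']
    have h := S.eq_of_encode_eq hlocal (congrFun hu)
      ⟨⟨p.1, hadj p p.2⟩, A.mem_R_iff.2 rfl, mt Allocation.mem_mappers.2 (hcut p p.2 p p.2)⟩
    simpa only [extend, dif_pos p.2] using h
  have hcard := Fintype.card_le_of_injective messages hinj
  rw [← hS, ← Nat.pow_le_pow_iff_right one_lt_two]
  simpa [Bits, ← pow_mul, mul_comm, Finset.prod_pow_eq_pow_sum] using hcard

end Coding

section Probability

theorem integral_abs_sub_integral_le_sqrt_variance {Ω : Type*} {mΩ : MeasurableSpace Ω}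
    {μ : Measure Ω} [IsProbabilityMeasure μ] {X : Ω → ℝ} (hX : MemLp X 2 μ) :
    ∫ ω, |X ω - μ[X]| ∂μ ≤ √(Var[X; μ]) := by
  have habs : MemLp (fun ω => |X ω - μ[X]|) 2 μ := (hX.sub (memLp_const _)).norm
  have hvar := variance_nonneg (fun ω => |X ω - μ[X]|) μ
  rw [variance_eq_sub habs] at hvar
  refine Real.le_sqrt_of_sq_le ?_
  simpa [variance_eq_integral hX.aemeasurable] using hvar

theorem integral_le_add_card_mul_sqrt {Ω κ : Type*} {mΩ : MeasurableSpace Ω} {μ : Measure Ω}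
    [IsProbabilityMeasure μ] {S : Finset κ} {X : κ → Ω → ℝ} {f : Ω → ℝ} {a v : ℝ}
    (hX : ∀ k ∈ S, MemLp (X k) 2 μ) (hf : Integrable f μ) (hfX : ∀ ω, ∃ k ∈ S, f ω ≤ X k ω)
    (hmean : ∀ k ∈ S, μ[X k] ≤ a) (hvar : ∀ k ∈ S, Var[X k; μ] ≤ v) :
    μ[f] ≤ a + S.card * √v := by
  have hdev : ∀ k ∈ S, Integrable (fun ω => |X k ω - μ[X k]|) μ := fun k hk =>
    (((hX k hk).integrable one_le_two).sub (integrable_const _)).abs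
  have hle : ∀ ω, f ω ≤ a + ∑ k ∈ S, |X k ω - μ[X k]| := by
    intro ω
    obtain ⟨k, hk, hfk⟩ := hfX ω
    have hsum := Finset.single_le_sum (f := fun k => |X k ω - μ[X k]|)
      (fun _ _ => abs_nonneg _) hk
    linarith [le_abs_self (X k ω - μ[X k]), hmean k hk]
  calc μ[f] ≤ ∫ ω, (a + ∑ k ∈ S, |X k ω - μ[X k]|) ∂μ :=
        integral_mono hf ((integrable_const a).add (integrable_finsetSum _ hdev)) hle
    _ = a + ∑ k ∈ S, ∫ ω, |X k ω - μ[X k]| ∂μ := by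
        rw [integral_add (integrable_const a) (integrable_finsetSum _ hdev),
          integral_finsetSum _ hdev]
        simp
    _ ≤ a + ∑ _k ∈ S, √v := by
        gcongr with k hk
        exact (integral_abs_sub_integral_le_sqrt_variance (hX k hk)).trans
          (Real.sqrt_le_sqrt (hvar k hk))
    _ = a + S.card * √v := by simp

variable {ι : Type*} (q : unitInterval)

theorem setBernoulli_real_subset_and_disjoint {F B : Finset ι} (h : Disjoint F B) :
    (setBernoulli Set.univ q).real {E : Set ι | ↑F ⊆ E ∧ Disjoint E ↑B} =
      (q : ℝ) ^ F.card * (1 - q) ^ B.card := by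
  classical
  have hpre : (fun p : ι → Prop => {i | p i}) ⁻¹' {E : Set ι | ↑F ⊆ E ∧ Disjoint E ↑B} =
      (↑(F ∪ B) : Set ι).pi fun i => if i ∈ F then {True} else {False} := by
    ext p
    have hF : ∀ i ∈ B, i ∉ F := fun i hB hF => Finset.disjoint_left.1 h hF hB
    simp only [Set.mem_preimage, Set.mem_ofPred_eq, Set.mem_pi, Finset.coe_union, Set.mem_union,
      Finset.mem_coe, Set.subset_def, Set.disjoint_right]
    grind
  rw [measureReal_def, setBernoulli_apply', hpre,
    Measure.infinitePi_pi _ (fun _ _ => MeasurableSet.of_discrete), Finset.prod_union h]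
  rw [Finset.prod_congr rfl fun i hi => by rw [if_pos hi],
    Finset.prod_congr (s₁ := B) rfl fun i hi => by rw [if_neg (Finset.disjoint_right.1 h hi)]]
  simp

variable [Finite ι]

theorem integral_indicator_mem (a : ι) :
    ∫ E : Set ι, E.indicator (1 : ι → ℝ) a ∂(setBernoulli Set.univ q) = q := by
  have h : (fun E : Set ι => E.indicator (1 : ι → ℝ) a) =
      Set.indicator {E : Set ι | ↑({a} : Finset ι) ⊆ E ∧ Disjoint E ↑(∅ : Finset ι)} 1 := by
    funext E
    by_cases ha : a ∈ E <;> simp [ha]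
  rw [h, integral_indicator_one (Set.toFinite _).measurableSet,
    setBernoulli_real_subset_and_disjoint q (Finset.disjoint_empty_right _)]
  simp

open scoped Classical in
theorem covariance_indicator_mem (a b : ι) :
    cov[fun E : Set ι => E.indicator (1 : ι → ℝ) a, fun E => E.indicator (1 : ι → ℝ) b;
      setBernoulli Set.univ q] = if a = b then (q : ℝ) * (1 - q) else 0 := by
  have hmul : ((fun E : Set ι => E.indicator (1 : ι → ℝ) a) * fun E => E.indicator 1 b) =
      Set.indicator {E : Set ι | ↑({a, b} : Finset ι) ⊆ E ∧ Disjoint E ↑(∅ : Finset ι)} 1 := by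
    funext E
    by_cases ha : a ∈ E <;> by_cases hb : b ∈ E <;> simp [ha, hb, Set.insert_subset_iff]
  rw [covariance_eq_sub .of_discrete .of_discrete, hmul,
    integral_indicator_one (Set.toFinite _).measurableSet,
    setBernoulli_real_subset_and_disjoint q (Finset.disjoint_empty_right _),
    integral_indicator_mem, integral_indicator_mem]
  split_ifs with hab
  · subst hab
    simp
    ring
  · simp [Finset.card_pair hab]
    ring

theorem integral_sum_indicator_mem_mul [Fintype ι] (c : ι → ℝ) :
    ∫ E : Set ι, ∑ a, E.indicator (1 : ι → ℝ) a * c a ∂(setBernoulli Set.univ q) =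
      q * ∑ a, c a := by
  rw [integral_finsetSum _ fun _ _ => .of_finite, Finset.mul_sum]
  simp only [integral_mul_const, integral_indicator_mem]

theorem variance_sum_indicator_mem_mul [Fintype ι] (c : ι → ℝ) :
    Var[fun E : Set ι => ∑ a, E.indicator (1 : ι → ℝ) a * c a; setBernoulli Set.univ q] =
      q * (1 - q) * ∑ a, c a ^ 2 := by
  classical
  rw [variance_fun_sum fun _ => .of_discrete, Finset.mul_sum]
  simp [covariance_mul_const_left, covariance_mul_const_right, covariance_indicator_mem, sq,
    mul_assoc]

end Probability

section BipartiteCount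

variable {n₁ n₂ : ℕ}

open scoped Classical in
theorem sum_adj_bipartiteGraph (E : Set (Fin n₁ × Fin n₂))
    (f : (Fin n₁ ⊕ Fin n₂) × (Fin n₁ ⊕ Fin n₂) → ℝ) :
    ∑ p, (if (bipartiteGraph E).Adj p.1 p.2 then f p else 0) =
      ∑ e : Fin n₁ × Fin n₂, E.indicator (1 : Fin n₁ × Fin n₂ → ℝ) e *
        (f (Sum.inl e.1, Sum.inr e.2) + f (Sum.inr e.2, Sum.inl e.1)) := by
  have hlr : ∀ a b, (bipartiteGraph E).Adj (Sum.inl a) (Sum.inr b) ↔ (a, b) ∈ E := by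
    simp [bipartiteGraph]
  have hrl : ∀ a b, (bipartiteGraph E).Adj (Sum.inr b) (Sum.inl a) ↔ (a, b) ∈ E := by
    simp [bipartiteGraph]
  have hll : ∀ a b, ¬ (bipartiteGraph E).Adj (Sum.inl a) (Sum.inl b) := by simp [bipartiteGraph]
  have hrr : ∀ a b, ¬ (bipartiteGraph E).Adj (Sum.inr a) (Sum.inr b) := by simp [bipartiteGraph]
  simp only [mul_add, Finset.sum_add_distrib, Fintype.sum_prod_type, Fintype.sum_sum_type, hlr,
    hrl, hll, hrr, if_false, Finset.sum_const_zero, zero_add, add_zero, Set.indicator_apply,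
    Pi.one_apply, ite_mul, one_mul, zero_mul]
  rw [add_comm, add_right_inj, Finset.sum_comm]

open scoped Classical in
theorem integral_sum_adj_bipartiteGraph (q : unitInterval)
    (f : (Fin n₁ ⊕ Fin n₂) × (Fin n₁ ⊕ Fin n₂) → ℝ) :
    ∫ E : Set (Fin n₁ × Fin n₂), ∑ p, (if (bipartiteGraph E).Adj p.1 p.2 then f p else 0)
        ∂(setBernoulli Set.univ q) =
      q * ∑ e : Fin n₁ × Fin n₂,
        (f (Sum.inl e.1, Sum.inr e.2) + f (Sum.inr e.2, Sum.inl e.1)) := by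
  simp_rw [sum_adj_bipartiteGraph, integral_sum_indicator_mem_mul]

/-- The number of adjacent pairs in `Q`. -/
noncomputable def adjCount {V : Type*} (G : SimpleGraph V) (Q : Finset (V × V)) : ℕ :=
  open scoped Classical in {p ∈ Q | G.Adj p.1 p.2}.card

variable (q : unitInterval) (Q : Finset ((Fin n₁ ⊕ Fin n₂) × (Fin n₁ ⊕ Fin n₂)))

open scoped Classical in
theorem adjCount_bipartiteGraph (E : Set (Fin n₁ × Fin n₂)) :
    (adjCount (bipartiteGraph E) Q : ℝ) =
      ∑ e : Fin n₁ × Fin n₂, E.indicator (1 : Fin n₁ × Fin n₂ → ℝ) e *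
        ((if (Sum.inl e.1, Sum.inr e.2) ∈ Q then 1 else 0) +
          if (Sum.inr e.2, Sum.inl e.1) ∈ Q then 1 else 0) := by
  rw [← sum_adj_bipartiteGraph E fun p => if p ∈ Q then 1 else 0, adjCount]
  simp_rw [← ite_and, Finset.sum_boole]
  congr 2
  ext p
  simp [and_comm]

theorem sum_cross_le_sum {f : (Fin n₁ ⊕ Fin n₂) × (Fin n₁ ⊕ Fin n₂) → ℝ} (hf : 0 ≤ f) :
    ∑ e : Fin n₁ × Fin n₂, (f (Sum.inl e.1, Sum.inr e.2) + f (Sum.inr e.2, Sum.inl e.1)) ≤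
      ∑ p, f p := by
  classical
  have h := sum_adj_bipartiteGraph Set.univ f
  simp only [Set.indicator_univ, Pi.one_apply, one_mul] at h
  rw [← h]
  gcongr with p
  split_ifs
  exacts [le_rfl, hf p]

open scoped Classical in
theorem sum_cross_mem_le_card :
    ∑ e : Fin n₁ × Fin n₂, ((if (Sum.inl e.1, Sum.inr e.2) ∈ Q then (1 : ℝ) else 0) +
      if (Sum.inr e.2, Sum.inl e.1) ∈ Q then 1 else 0) ≤ Q.card := by
  refine (sum_cross_le_sum (f := fun p => if p ∈ Q then 1 else 0) fun p => ?_).trans_eq (by simp)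
  dsimp only [Pi.zero_apply]
  positivity

theorem integral_adjCount_bipartiteGraph_le :
    ∫ E, (adjCount (bipartiteGraph E) Q : ℝ) ∂(setBernoulli Set.univ q) ≤ q * Q.card := by
  simp_rw [adjCount_bipartiteGraph, integral_sum_indicator_mem_mul]
  exact mul_le_mul_of_nonneg_left (sum_cross_mem_le_card Q) q.2.1

theorem variance_adjCount_bipartiteGraph_le :
    Var[fun E => (adjCount (bipartiteGraph E) Q : ℝ); setBernoulli Set.univ q] ≤
      2 * (q * Q.card) := by
  classical
  simp_rw [adjCount_bipartiteGraph, variance_sum_indicator_mem_mul]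
  have hsq : ∀ (a b : Prop) [Decidable a] [Decidable b],
      ((if a then (1 : ℝ) else 0) + if b then 1 else 0) ^ 2 ≤
        2 * ((if a then 1 else 0) + if b then 1 else 0) := by
    intro a b _ _
    split_ifs <;> norm_num
  calc _ ≤ (q : ℝ) * 1 * ∑ e : Fin n₁ × Fin n₂,
        2 * ((if (Sum.inl e.1, Sum.inr e.2) ∈ Q then (1 : ℝ) else 0) +
          if (Sum.inr e.2, Sum.inl e.1) ∈ Q then 1 else 0) := by
        gcongr
        · exact mul_nonneg q.2.1 zero_le_one
        · exact q.2.1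
        · linarith [q.2.1]
        · exact hsq _ _
    _ ≤ 2 * (q * Q.card) := by
        rw [← Finset.mul_sum, mul_one, mul_left_comm]
        gcongr
        · exact q.2.1
        · exact sum_cross_mem_le_card Q

end BipartiteCount

section Converse

variable {V : Type*} [Fintype V] {K r : ℕ}

namespace Allocation

theorem sum_card_mappers (A : Allocation V K r) (hK : 0 < K) :
    ∑ v, (A.mappers v).card = r * Fintype.card V := by
  classical
  have hcount : ∑ v, (A.mappers v).card = ∑ k, (A.M k).card := by
    simpa [Finset.bipartiteAbove, Finset.bipartiteBelow, mappers] using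
      Finset.sum_card_bipartiteAbove_eq_sum_card_bipartiteBelow
        (s := (Finset.univ : Finset V)) (t := (Finset.univ : Finset (Fin K)))
        (fun v k => v ∈ A.M k)
  refine Nat.eq_of_mul_eq_mul_left hK ?_
  rw [hcount, Finset.mul_sum, Finset.sum_congr rfl fun k _ => A.map_card k]
  simp

theorem card_reducer_mem (A : Allocation V K r) (hK : 0 < K) (B : Finset (Fin K)) :
    ((Finset.univ.filter fun v => A.reducer v ∈ B).card : ℝ) =
      B.card * (Fintype.card V / K) := by
  classical
  have hfiber : Finset.univ.filter (fun v => A.reducer v ∈ B) = B.biUnion A.R := by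
    ext v
    simp [mem_R_iff]
  have hR : ∀ k, ((A.R k).card : ℝ) = Fintype.card V / K := by
    intro k
    rw [eq_div_iff (by positivity), mul_comm]
    exact_mod_cast A.reduce_card k
  rw [hfiber, Finset.card_biUnion fun k _ l _ hkl => A.reduce_disjoint k l hkl]
  simp [hR]

theorem le_card_reducer_notMem (A : Allocation V K r) (hK : 0 < K) (B : Finset (Fin K))
    {ι : Type*} [Fintype ι] {g : ι → V} (hg : Function.Injective g) :
    (Fintype.card ι : ℝ) - B.card * (Fintype.card V / K) ≤
      (Finset.univ.filter fun i => A.reducer (g i) ∉ B).card := by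
  have hsplit := Finset.card_filter_add_card_filter_not (s := (Finset.univ : Finset ι))
    (p := fun i => A.reducer (g i) ∈ B)
  have hle : (Finset.univ.filter fun i => A.reducer (g i) ∈ B).card ≤
      (Finset.univ.filter fun v => A.reducer v ∈ B).card :=
    Finset.card_le_card_of_injOn g (by intro i; simp) hg.injOn
  rw [← A.card_reducer_mem hK B, sub_le_iff_le_add']
  exact_mod_cast hsplit.symm.le.trans (Nat.add_le_add_right hle _)

/-- The probability that a random set of machines, which contains every machine independently with
probability `x`, contains the reducer of `i` but no machine mapping `j`, where `p = (i, j)`. -/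
noncomputable def cutProb (A : Allocation V K r) (x : unitInterval) (p : V × V) : ℝ :=
  (setBernoulli Set.univ x).real
    {S : Set (Fin K) | A.reducer p.1 ∈ S ∧ Disjoint S ↑(A.mappers p.2)}

theorem cutProb_eq (A : Allocation V K r) (x : unitInterval) (p : V × V) :
    A.cutProb x p = if A.reducer p.1 ∉ A.mappers p.2 then
      (x : ℝ) * (1 - x) ^ (A.mappers p.2).card else 0 := by
  unfold cutProb
  split_ifs with h
  · have hempty : {S : Set (Fin K) | A.reducer p.1 ∈ S ∧ Disjoint S ↑(A.mappers p.2)} = ∅ :=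
      Set.eq_empty_of_forall_notMem fun S hS =>
        Set.disjoint_left.1 hS.2 hS.1 (Finset.mem_coe.2 h)
    rw [hempty, measureReal_empty]
  · simpa using setBernoulli_real_subset_and_disjoint x (Finset.disjoint_singleton_left.2 h)

end Allocation

open scoped Classical in
/-- Every set of machines gives a cut-set bound; average it over the random set of `cutProb`. -/
theorem mul_sum_cutProb_le_minBits (G : SimpleGraph V) (A : Allocation V K r) (T : ℕ)
    (x : unitInterval) :
    T * ∑ p, (if G.Adj p.1 p.2 then A.cutProb x p else 0) ≤ minBits G A T := by
  let cut (S : Set (Fin K)) : Finset (V × V) :=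
    {p | G.Adj p.1 p.2 ∧ A.reducer p.1 ∈ S ∧ Disjoint S ↑(A.mappers p.2)}
  have hcut : ∀ S, ((cut S).card * T : ℝ) ≤ minBits G A T := by
    intro S
    have h := card_mul_le_minBits_of_cut (A := A) (T := T) (cut S)
      (fun p hp => (Finset.mem_filter.1 hp).2.1) fun p hp p' hp' hmem =>
        Set.disjoint_left.1 (Finset.mem_filter.1 hp').2.2.2 (Finset.mem_filter.1 hp).2.2.1 hmem
    exact_mod_cast h
  have hcard : ∀ S, ((cut S).card : ℝ) = ∑ p : V × V, if G.Adj p.1 p.2 then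
      {S : Set (Fin K) | A.reducer p.1 ∈ S ∧ Disjoint S ↑(A.mappers p.2)}.indicator
        (1 : Set (Fin K) → ℝ) S else 0 := by
    intro S
    simp [cut, Set.indicator_apply, ← ite_and]
  have hmean : ∑ p, (if G.Adj p.1 p.2 then A.cutProb x p else 0) =
      ∫ S, ((cut S).card : ℝ) ∂(setBernoulli Set.univ x) := by
    simp_rw [hcard]
    rw [integral_finsetSum _ fun _ _ => .of_finite]
    refine Finset.sum_congr rfl fun p _ => ?_
    split_ifs
    · exact (integral_indicator_one (Set.toFinite _).measurableSet).symm
    · simp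
  rw [hmean, mul_comm, ← integral_mul_const]
  exact (integral_mono .of_finite .of_finite hcut).trans_eq (by simp)

/-- The left side is the tangent at `m = r` of the convex function `(1 - 2m/K)(1 - m/(2r))`, which
is at most the right side by Bernoulli's inequality as long as `2m ≤ K`. -/
theorem tangent_le_max_mul_pow (hr : 1 ≤ r) (hK : 0 < K) (m : ℕ) :
    (1 : ℝ) - r / K - m / (2 * r) ≤ max 0 (1 - 2 * (m : ℝ) / K) * (1 - 1 / (2 * (r : ℝ))) ^ m := by
  have hr' : (1 : ℝ) ≤ r := by exact_mod_cast hr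
  have hK' : (0 : ℝ) < K := by exact_mod_cast hK
  have hx : 1 / (2 * (r : ℝ)) ≤ 1 := by rw [div_le_one (by positivity)]; linarith
  rcases le_total (K : ℝ) (2 * m) with h | h
  · refine le_trans ?_ (mul_nonneg (le_max_left _ _) (pow_nonneg (by linarith) _))
    have hclear : 1 - (r : ℝ) / K - m / (2 * r) =
        (2 * r * K - 2 * r ^ 2 - K * m) / (2 * r * K) := by field_simp
    rw [hclear]
    exact div_nonpos_of_nonpos_of_nonneg (by nlinarith [sq_nonneg ((K : ℝ) - 2 * r)])
      (by positivity)
  · have hnonneg : 0 ≤ 1 - 2 * (m : ℝ) / K := by rwa [sub_nonneg, div_le_one hK']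
    have hbernoulli : 1 - (m : ℝ) / (2 * r) ≤ (1 - 1 / (2 * (r : ℝ))) ^ m := by
      have := one_add_mul_le_pow (a := -(1 / (2 * (r : ℝ)))) (by linarith) m
      rw [← sub_eq_add_neg] at this
      exact (by ring : 1 - (m : ℝ) / (2 * r) = 1 + m * -(1 / (2 * r))).trans_le this
    have htangent : (1 - 2 * (m : ℝ) / K) * (1 - m / (2 * r)) - (1 - r / K - m / (2 * r)) =
        (m - r) ^ 2 / (r * K) := by field_simp; ring
    have : 0 ≤ ((m : ℝ) - r) ^ 2 / (r * K) := by positivity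
    rw [max_eq_right hnonneg]
    linarith [mul_le_mul_of_nonneg_left hbernoulli hnonneg]

theorem le_sum_cutProb (A : Allocation V K r) (hr : 1 ≤ r) (hK : 0 < K) {x : unitInterval}
    (hx : (x : ℝ) = 1 / (2 * r)) {ι : Type*} [Fintype ι] {g : ι → V} (hg : Function.Injective g)
    (j : V) {d : ℝ} (hd0 : 0 ≤ d) (hd : (Fintype.card V : ℝ) / 2 - d ≤ Fintype.card ι) :
    1 / (2 * r) * (Fintype.card V / 2 * (1 - r / K - (A.mappers j).card / (2 * r)) - d) ≤
      ∑ i, A.cutProb x (g i, j) := by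
  have hx1 : (0 : ℝ) ≤ 1 - x := sub_nonneg.2 x.2.2
  set n : ℝ := (Fintype.card V : ℝ)
  set m := (A.mappers j).card
  have hcount : max 0 (n / 2 * (1 - 2 * (m : ℝ) / K) - d) ≤
      (Finset.univ.filter fun i => A.reducer (g i) ∉ A.mappers j).card := by
    refine max_le (Nat.cast_nonneg _)
      (le_trans ?_ (A.le_card_reducer_notMem hK (A.mappers j) hg))
    have : n / 2 * (1 - 2 * (m : ℝ) / K) = n / 2 - m * (n / K) := by ring
    linarith
  have hmax : n / 2 * max 0 (1 - 2 * (m : ℝ) / K) - d ≤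
      max 0 (n / 2 * (1 - 2 * (m : ℝ) / K) - d) := by
    rw [mul_max_of_nonneg _ _ (by positivity), mul_zero]
    rcases max_choice 0 (n / 2 * (1 - 2 * (m : ℝ) / K)) with h | h <;> rw [h]
    · exact le_max_of_le_left (by linarith)
    · exact le_max_right _ _
  have hpow : (1 - (x : ℝ)) ^ m ≤ 1 := pow_le_one₀ hx1 (by linarith [x.2.1])
  have hsum : ∑ i, A.cutProb x (g i, j) =
      x * ((Finset.univ.filter fun i => A.reducer (g i) ∉ A.mappers j).card * (1 - x) ^ m) := by
    simp_rw [A.cutProb_eq]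
    rw [← Finset.sum_filter, Finset.sum_const, nsmul_eq_mul]
    ring
  rw [hsum, ← hx]
  refine mul_le_mul_of_nonneg_left ?_ x.2.1
  calc n / 2 * (1 - r / K - m / (2 * r)) - d
      ≤ n / 2 * (max 0 (1 - 2 * (m : ℝ) / K) * (1 - x) ^ m) - d * (1 - x) ^ m := by
        refine sub_le_sub (mul_le_mul_of_nonneg_left ?_ (by positivity))
          (mul_le_of_le_one_right hd0 hpow)
        rw [hx]
        exact tangent_le_max_mul_pow hr hK m
    _ = (n / 2 * max 0 (1 - 2 * (m : ℝ) / K) - d) * (1 - x) ^ m := by ring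
    _ ≤ _ := mul_le_mul_of_nonneg_right (hmax.trans hcount) (pow_nonneg hx1 _)

variable {n₁ n₂ : ℕ}

theorem le_sum_cross_cutProb (A : Allocation (Fin n₁ ⊕ Fin n₂) K r) (hr : 1 ≤ r) (hK : 0 < K)
    {x : unitInterval} (hx : (x : ℝ) = 1 / (2 * r)) {n : ℝ} (hn : n = ((n₁ + n₂ : ℕ) : ℝ)) :
    1 / (8 * r) * (n ^ 2 * (1 - 2 * r / K) - 2 * (n * |(n₁ : ℝ) - n₂|)) ≤
      ∑ e : Fin n₁ × Fin n₂,
        (A.cutProb x (Sum.inl e.1, Sum.inr e.2) + A.cutProb x (Sum.inr e.2, Sum.inl e.1)) := by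
  have : (0 : ℝ) < r := by exact_mod_cast hr
  have : (0 : ℝ) < K := by exact_mod_cast hK
  have hcard : ((Fintype.card (Fin n₁ ⊕ Fin n₂) : ℕ) : ℝ) = n := by simp [hn]
  have hadd : n = n₁ + n₂ := by rw [hn]; push_cast; rfl
  set D := |(n₁ : ℝ) - n₂|
  have hD0 : 0 ≤ D / 2 := by positivity
  let bound (j : Fin n₁ ⊕ Fin n₂) : ℝ :=
    1 / (2 * r) * (n / 2 * (1 - r / K - (A.mappers j).card / (2 * r)) - D / 2)
  have hbound : ∑ j, bound j = 1 / (8 * r) * (n ^ 2 * (1 - 2 * r / K) - 2 * (n * D)) := by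
    have hs : ∑ j, ((A.mappers j).card : ℝ) = r * n := by
      rw [← hcard]; exact_mod_cast A.sum_card_mappers hK
    simp only [bound]
    rw [← Finset.mul_sum, Finset.sum_sub_distrib, ← Finset.mul_sum, Finset.sum_sub_distrib,
      ← Finset.sum_div, hs]
    simp only [Finset.sum_const, Finset.card_univ, nsmul_eq_mul, hcard]
    field_simp
    ring
  have hleft : ∀ b, bound (Sum.inr b) ≤ ∑ a, A.cutProb x (Sum.inl a, Sum.inr b) := by
    intro b
    have h := le_sum_cutProb A hr hK hx Sum.inl_injective (Sum.inr b) hD0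
      (by rw [hcard, Fintype.card_fin]; linarith [neg_abs_le ((n₁ : ℝ) - n₂)])
    rwa [hcard] at h
  have hright : ∀ a, bound (Sum.inl a) ≤ ∑ b, A.cutProb x (Sum.inr b, Sum.inl a) := by
    intro a
    have h := le_sum_cutProb A hr hK hx Sum.inr_injective (Sum.inl a) hD0
      (by rw [hcard, Fintype.card_fin]; linarith [le_abs_self ((n₁ : ℝ) - n₂)])
    rwa [hcard] at h
  rw [← hbound, Fintype.sum_sum_type, Finset.sum_add_distrib, add_comm, Fintype.sum_prod_type_right,
    Fintype.sum_prod_type]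
  exact add_le_add (Finset.sum_le_sum fun b _ => hleft b) (Finset.sum_le_sum fun a _ => hright a)

theorem le_integral_commLoad {T : ℕ} (q : unitInterval) (hT : 0 < T) (hr : 1 ≤ r) (hK : 0 < K)
    (hn : 0 < n₁ + n₂) (A : Allocation (Fin n₁ ⊕ Fin n₂) K r) :
    (q : ℝ) * (1 / (8 * r) * (1 - 2 * r / K - 2 * (|(n₁ : ℝ) - n₂| / ((n₁ + n₂ : ℕ) : ℝ)))) ≤
      ∫ E, commLoad (bipartiteGraph E) A T ∂(setBernoulli Set.univ q) := by
  classical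
  have hr' : (1 : ℝ) ≤ r := by exact_mod_cast hr
  set n : ℝ := ((n₁ + n₂ : ℕ) : ℝ) with hn_def
  have hn0 : 0 < n := by rw [hn_def]; exact_mod_cast hn
  have : (0 : ℝ) < T := by exact_mod_cast hT
  let x : unitInterval := ⟨1 / (2 * r), by positivity, by rw [div_le_one (by positivity)]; linarith⟩
  have hcut : ∀ E : Set (Fin n₁ × Fin n₂),
      (∑ p, if (bipartiteGraph E).Adj p.1 p.2 then A.cutProb x p else 0) / n ^ 2 ≤
        commLoad (bipartiteGraph E) A T := by
    intro E
    have h := mul_sum_cutProb_le_minBits (bipartiteGraph E) A T x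
    rw [commLoad, Fintype.card_sum, Fintype.card_fin, Fintype.card_fin, ← hn_def,
      div_le_div_iff₀ (by positivity) (by positivity)]
    nlinarith [mul_le_mul_of_nonneg_right h (sq_nonneg n)]
  calc _ = (q : ℝ) * (1 / (8 * r) * (n ^ 2 * (1 - 2 * r / K) - 2 * (n * |(n₁ : ℝ) - n₂|))) /
          n ^ 2 := by
        field_simp
    _ ≤ (q : ℝ) * (∑ e : Fin n₁ × Fin n₂, (A.cutProb x (Sum.inl e.1, Sum.inr e.2) +
          A.cutProb x (Sum.inr e.2, Sum.inl e.1))) / n ^ 2 := by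
        gcongr
        · exact q.2.1
        · exact le_sum_cross_cutProb A hr hK rfl hn_def
    _ = ∫ E, (∑ p, if (bipartiteGraph E).Adj p.1 p.2 then A.cutProb x p else 0) / n ^ 2
          ∂(setBernoulli Set.univ q) := by
        rw [integral_div, integral_sum_adj_bipartiteGraph]
    _ ≤ _ := integral_mono .of_finite .of_finite hcut

end Converse

section CodedMulticast

open scoped Classical in
/-- The bits of the intermediate values belonging to the adjacent pairs in `Q`. -/
noncomputable def valueBits {V : Type*} (G : SimpleGraph V) (T : ℕ) (Q : Finset (V × V)) :
    Finset ((V × V) × Fin T) :=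
  {p ∈ Q | G.Adj p.1 p.2} ×ˢ Finset.univ

theorem card_valueBits {V : Type*} (G : SimpleGraph V) (T : ℕ) (Q : Finset (V × V)) :
    (valueBits G T Q).card = adjCount G Q * T := by
  simp [valueBits, adjCount]

variable {V : Type*} [Fintype V] {K r : ℕ}

open scoped Classical in
/-- The values that machine `k` of the group `S` lacks while all other machines of `S` know them:
`k` reduces the first vertex, and the second vertex belongs to the batch `S \ {k}`. -/
noncomputable def Allocation.groupPairs (A : Allocation V K r) (batch : V → Finset (Fin K))
    (S : Finset (Fin K)) (k : Fin K) : Finset (V × V) :=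
  {p | A.reducer p.1 = k ∧ batch p.2 = S.erase k}

theorem exists_injOn_product_range {α κ : Type*} [Nonempty κ] (s : Finset α) (t : Finset κ)
    (m : ℕ) : ∃ f : α → κ × ℕ, s.card ≤ t.card * m →
      (∀ a ∈ s, f a ∈ t ×ˢ Finset.range m) ∧ Set.InjOn f s := by
  by_cases h : s.card ≤ t.card * m
  · obtain ⟨f, hf, hinj⟩ := s.finite_toSet.exists_injOn_of_encard_le
      (t := (↑(t ×ˢ Finset.range m) : Set (κ × ℕ)))
      (by simp only [Set.encard_coe_eq_coe_finsetCard]; exact_mod_cast by simpa using h)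
    exact ⟨f, fun _ => ⟨hf, hinj⟩⟩
  · exact ⟨fun _ => Classical.arbitrary _, fun h' => (h h').elim⟩

variable {G : SimpleGraph V} {A : Allocation V K r} {T : ℕ} {batch : V → Finset (Fin K)}
  {U : Finset (V × V)} {𝒮 : Finset (Finset (Fin K))} {w : Finset (Fin K) → ℕ}

open scoped Classical in
/-- The values of `U` are sent uncoded. In the group `S`, slot `m` of machine `l` carries the
exclusive or of the bits `b` with `f S k b = (l, m)`, one for each other machine `k ∈ S`. -/
theorem minBits_le_of_groups (hmap : ∀ j, batch j ⊆ A.mappers j)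
    (hgroup : ∀ p ∈ A.missing G, p ∉ U → insert (A.reducer p.1) (batch p.2) ∈ 𝒮)
    (f : Finset (Fin K) → Fin K → (V × V) × Fin T → Fin K × ℕ)
    (hf : ∀ S ∈ 𝒮, ∀ k ∈ S, ∀ b ∈ valueBits G T (A.groupPairs batch S k),
      f S k b ∈ S.erase k ×ˢ Finset.range (w S))
    (hinj : ∀ S ∈ 𝒮, ∀ k ∈ S, Set.InjOn (f S k) (valueBits G T (A.groupPairs batch S k))) :
    minBits G A T ≤ adjCount G U * T + ∑ S ∈ 𝒮, S.card * w S := by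
  let group (p : V × V) : Finset (Fin K) := insert (A.reducer p.1) (batch p.2)
  have hself (p : V × V) : A.reducer p.1 ∈ group p := Finset.mem_insert_self _ _
  have hbatch : ∀ p ∈ A.missing G, (group p).erase (A.reducer p.1) = batch p.2 :=
    fun p hp => Finset.erase_insert fun h => (Allocation.mem_missing.1 hp).2 (hmap _ h)
  have hmem : ∀ b : (V × V) × Fin T, b.1 ∈ A.missing G →
      b ∈ valueBits G T (A.groupPairs batch (group b.1) (A.reducer b.1.1)) := fun b hb => by
    simp [valueBits, Allocation.groupPairs, hbatch _ hb, (Allocation.mem_missing.1 hb).1]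
  have hpiece : ∀ b : (V × V) × Fin T, b.1 ∈ A.missing G → b.1 ∉ U →
      f (group b.1) (A.reducer b.1.1) b ∈ batch b.1.2 ×ˢ Finset.range (w (group b.1)) :=
    fun b hb hU => hbatch _ hb ▸ hf _ (hgroup _ hb hU) _ (hself _) b (hmem b hb)
  let slots := (valueBits G T U).disjSum (𝒮.sigma fun S => S ×ˢ Finset.range (w S))
  have hslots : slots.card = adjCount G U * T + ∑ S ∈ 𝒮, S.card * w S := by
    simp [slots, card_valueBits]
  let slot (b : (V × V) × Fin T) : ((V × V) × Fin T) ⊕ Σ _ : Finset (Fin K), Fin K × ℕ :=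
    if b.1 ∈ U then .inl b else .inr ⟨group b.1, f (group b.1) (A.reducer b.1.1) b⟩
  rw [← hslots]
  refine minBits_le_card_slots G A T slots
    (Sum.elim (fun b => (A.map_cover b.1.2).choose) fun s => s.2.1) slot
    (fun b hb => ?_) (fun b hb => ?_) fun b b' hb hb' hne hbb' => ?_
  · by_cases hU : b.1 ∈ U
    · simp [slots, slot, hU, valueBits, (Allocation.mem_missing.1 hb).1]
    · obtain ⟨hsend, hpos⟩ := Finset.mem_product.1 (hpiece b hb hU)
      simpa [slots, slot, hU, group] using
        ⟨hgroup _ hb hU, .inr hsend, Finset.mem_range.1 hpos⟩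
  · by_cases hU : b.1 ∈ U
    · simpa [slot, hU] using (A.map_cover b.1.2).choose_spec
    · simpa [slot, hU] using hmap _ (Finset.mem_product.1 (hpiece b hb hU)).1
  · by_cases hU : b.1 ∈ U <;> by_cases hU' : b'.1 ∈ U <;>
      simp only [slot, hU, hU', if_true, if_false, reduceCtorEq, Sum.inl.injEq, Sum.inr.injEq,
        Sigma.mk.injEq, heq_eq_eq] at hbb'
    · exact (hne hbb').elim
    · obtain ⟨hS, hpos⟩ := hbb'
      have hk : A.reducer b.1.1 ≠ A.reducer b'.1.1 := fun hk => hne <|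
        hinj (group b.1) (hgroup _ hb hU) _ (hself _) (hmem b hb)
          (by rw [hS, hk]; exact hmem b' hb') (by rw [hpos, hS, hk])
      refine hmap _ ?_
      rw [← hbatch _ hb', ← hS]
      exact Finset.mem_erase.2 ⟨hk, hself _⟩

open scoped Classical in
theorem minBits_le_coded (hmap : ∀ j, batch j ⊆ A.mappers j) (hcard : ∀ S ∈ 𝒮, S.card = r + 1)
    (hgroup : ∀ p ∈ A.missing G, p ∉ U → insert (A.reducer p.1) (batch p.2) ∈ 𝒮)
    (hw : ∀ S ∈ 𝒮, ∀ k ∈ S, adjCount G (A.groupPairs batch S k) * T ≤ r * w S) :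
    minBits G A T ≤ adjCount G U * T + (r + 1) * ∑ S ∈ 𝒮, w S := by
  have hsplit : ∀ S k, ∃ f : (V × V) × Fin T → Fin K × ℕ, S ∈ 𝒮 → k ∈ S →
      (∀ b ∈ valueBits G T (A.groupPairs batch S k), f b ∈ S.erase k ×ˢ Finset.range (w S)) ∧
      Set.InjOn f (valueBits G T (A.groupPairs batch S k)) := by
    intro S k
    have : Nonempty (Fin K) := ⟨k⟩
    obtain ⟨f, hf⟩ := exists_injOn_product_range (valueBits G T (A.groupPairs batch S k))
      (S.erase k) (w S)
    refine ⟨f, fun hS hk => hf ?_⟩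
    rw [card_valueBits, Finset.card_erase_of_mem hk, hcard S hS, Nat.add_sub_cancel]
    exact hw S hS k hk
  choose f hf using hsplit
  refine (minBits_le_of_groups hmap hgroup f (fun S hS k hk => (hf S k hS hk).1)
    fun S hS k hk => (hf S k hS hk).2).trans_eq ?_
  rw [Finset.mul_sum, Finset.sum_congr rfl fun S hS => by rw [hcard S hS]]

end CodedMulticast

section Design

theorem exists_map_of_card_fiber_eq {V β B : Type*} [Fintype V] [Fintype β] [DecidableEq β]
    [DecidableEq B] (σ : V → B) (τ : β → B) (c : β → ℕ)
    (h : ∀ a, ∑ b with τ b = a, c b = (Finset.univ.filter fun v => σ v = a).card) :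
    ∃ f : V → β, (∀ v, τ (f v) = σ v) ∧ ∀ b, (Finset.univ.filter fun v => f v = b).card = c b := by
  have hcount : ∀ t : Finset β,
      (Finset.univ.filter fun w : Σ b, Fin (c b) => w.1 ∈ t).card = ∑ b ∈ t, c b := by
    intro t
    have hsigma : (Finset.univ.filter fun w : Σ b, Fin (c b) => w.1 ∈ t) =
        t.sigma fun _ => Finset.univ := by
      ext
      simp
    simp [hsigma]
  have hfiber : ∀ a, Nonempty ({v // σ v = a} ≃ {w : Σ b, Fin (c b) // τ w.1 = a}) := by
    intro a
    refine ⟨Fintype.equivOfCardEq ?_⟩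
    simpa [Fintype.card_subtype, h a] using (hcount {b | τ b = a}).symm
  let φ := Equiv.ofFiberEquiv fun a => (hfiber a).some
  refine ⟨fun v => (φ v).1, Equiv.ofFiberEquiv_map fun a => (hfiber a).some, fun b => ?_⟩
  rw [← Finset.sum_singleton c b, ← hcount {b}]
  exact Finset.card_equiv φ (by simp)

theorem exists_map_of_card_eq_mul {V β : Type*} [Fintype V] [Fintype β] [DecidableEq β] {s : ℕ}
    (h : Fintype.card V = Fintype.card β * s) :
    ∃ f : V → β, ∀ b, (Finset.univ.filter fun v => f v = b).card = s :=
  (exists_map_of_card_fiber_eq (fun _ => ()) (fun _ : β => ()) (fun _ => s) (by simp [h])).imp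
    fun _ hf => hf.2

variable {V : Type*} [Fintype V] {K r s : ℕ}

open scoped Classical in
theorem exists_allocation_of_cover (hrK : r ≤ K) (hs : Fintype.card V = K * s)
    (ρ : V → Fin K) (hρ : ∀ k, (Finset.univ.filter fun v => ρ v = k).card = s)
    (B : Fin K → Finset V) (hcover : ∀ v, ∃ k, v ∈ B k) (hB : ∀ k, (B k).card ≤ r * s) :
    ∃ A : Allocation V K r, A.reducer = ρ ∧ ∀ k, B k ⊆ A.M k := by
  choose M hBM hM using fun k => Finset.exists_superset_card_eq (hB k)
    (hs ▸ Nat.mul_le_mul_right s hrK)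
  let A : Allocation V K r :=
    { M := M
      R := fun k => Finset.univ.filter fun v => ρ v = k
      map_cover := fun v => (hcover v).imp fun k hk => hBM k hk
      map_card := fun k => by rw [hM, hs]; ring
      reduce_cover := fun v => ⟨ρ v, by simp⟩
      reduce_disjoint := fun k l hkl => Finset.disjoint_filter.2 fun v _ hk hl => hkl (hk ▸ hl)
      reduce_card := fun k => by rw [hρ, hs] }
  exact ⟨A, funext fun v => A.mem_R_iff.1 (by simp [A]), hBM⟩

theorem nonempty_allocation (hr : 1 ≤ r) (hrK : r ≤ K) (hdvd : K ∣ Fintype.card V) :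
    Nonempty (Allocation V K r) := by
  classical
  obtain ⟨s, hs⟩ := hdvd
  obtain ⟨ρ, hρ⟩ := exists_map_of_card_eq_mul (V := V) (β := Fin K) (s := s) (by simpa using hs)
  obtain ⟨A, -⟩ := exists_allocation_of_cover (r := r) hrK hs ρ hρ
    (fun k => Finset.univ.filter fun v => ρ v = k) (fun v => ⟨ρ v, by simp⟩)
    fun k => by rw [hρ]; exact Nat.le_mul_of_pos_left s hr
  exact ⟨A⟩

end Design

section Batching

variable {V : Type*} [Fintype V] {K r h s : ℕ}

/-- The machines of one colour, when the machines are split into two halves by `side`. -/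
def machineHalf (side : Fin K → Bool) (a : Bool) : Finset (Fin K) := {k | side k = a}

/-- The number of vertices in the batch `P` reduced by machine `k`: the `s` vertices reduced by `k`
are spread evenly over the `r`-subsets of the half opposite to `k`, and the remaining vertices form
the batch `∅`. -/
def batchSize (side : Fin K → Bool) (r s : ℕ) (c : Fin K × Finset (Fin K)) : ℕ :=
  (if c.2 ∈ (machineHalf side (!side c.1)).powersetCard r then
      s / ((machineHalf side (!side c.1)).card.choose r) else 0) +
    if c.2 = ∅ then s % ((machineHalf side (!side c.1)).card.choose r) else 0

theorem sum_batchSize (side : Fin K → Bool) (r s : ℕ) (k : Fin K) :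
    ∑ P, batchSize side r s (k, P) = s := by
  simp only [batchSize, Finset.sum_add_distrib, Finset.sum_ite_mem, Finset.univ_inter,
    Finset.sum_const, Finset.card_powersetCard, smul_eq_mul, Finset.sum_ite_eq', Finset.mem_univ,
    if_true]
  exact Nat.div_add_mod _ _

/-- A reducer map `ρ` and a batch map on the vertices, compatible with the colouring `σ`, with batch
sizes `batchSize`. -/
structure IsBatching (side : Fin K → Bool) (r s : ℕ) (σ : V → Bool) (ρ : V → Fin K)
    (batch : V → Finset (Fin K)) : Prop where
  side_reducer : ∀ v, side (ρ v) = σ v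
  card_eq : ∀ k P, (Finset.univ.filter fun v => ρ v = k ∧ batch v = P).card =
    batchSize side r s (k, P)

theorem exists_isBatching {side : Fin K → Bool} (hside : ∀ a, (machineHalf side a).card = h)
    {σ : V → Bool} (hσ : ∀ a, (Finset.univ.filter fun v => σ v = a).card = h * s) :
    ∃ ρ batch, IsBatching side r s σ ρ batch := by
  obtain ⟨f, hf, hcard⟩ := exists_map_of_card_fiber_eq σ
    (fun c : Fin K × Finset (Fin K) => side c.1) (batchSize side r s) fun a => by
      rw [hσ, ← hside a, Finset.sum_filter, Fintype.sum_prod_type, machineHalf, ← smul_eq_mul,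
        ← Finset.sum_const, Finset.sum_filter]
      refine Finset.sum_congr rfl fun k _ => ?_
      split_ifs
      exacts [sum_batchSize side r s k, Finset.sum_const_zero]
  exact ⟨fun v => (f v).1, fun v => (f v).2, hf,
    fun k P => by simpa [Prod.ext_iff] using hcard (k, P)⟩

namespace IsBatching

variable {side : Fin K → Bool} {σ : V → Bool} {ρ : V → Fin K} {batch : V → Finset (Fin K)}

theorem card_reducer_eq (hb : IsBatching side r s σ ρ batch) (k : Fin K) :
    (Finset.univ.filter fun v => ρ v = k).card = s := by
  rw [← sum_batchSize side r s k,
    Finset.card_eq_sum_card_fiberwise fun v _ => Finset.mem_univ (batch v)]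
  simp_rw [← hb.card_eq, Finset.filter_filter]

theorem card_batch_eq (hb : IsBatching side r s σ ρ batch) (P : Finset (Fin K)) :
    (Finset.univ.filter fun v => batch v = P).card = ∑ k, batchSize side r s (k, P) := by
  rw [Finset.card_eq_sum_card_fiberwise fun v _ => Finset.mem_univ (ρ v)]
  simp_rw [← hb.card_eq, Finset.filter_filter, and_comm]

theorem batch_mem (hb : IsBatching side r s σ ρ batch) (v : V) :
    batch v ∈ (machineHalf side (!σ v)).powersetCard r ∨ batch v = ∅ := by
  by_contra! hne
  have hcard := hb.card_eq (ρ v) (batch v)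
  rw [batchSize, hb.side_reducer, if_neg hne.1, if_neg hne.2.ne_empty, Finset.card_eq_zero] at hcard
  exact Finset.notMem_empty v (hcard ▸ Finset.mem_filter.2 ⟨Finset.mem_univ v, rfl, rfl⟩)

theorem card_batch_eq_empty_le (hb : IsBatching side r s σ ρ batch) (hr : 1 ≤ r) (hrh : r ≤ h)
    (hside : ∀ a, (machineHalf side a).card = h) :
    (Finset.univ.filter fun v => batch v = ∅).card ≤ K * h.choose r := by
  rw [hb.card_batch_eq]
  refine (Finset.sum_le_card_nsmul _ _ (h.choose r) fun k _ => ?_).trans_eq (by simp)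
  simpa [batchSize, hside, (Nat.one_le_iff_ne_zero.1 hr).symm] using
    (Nat.mod_lt s (Nat.choose_pos hrh)).le

theorem card_batch_eq_le (hb : IsBatching side r s σ ρ batch)
    (hside : ∀ a, (machineHalf side a).card = h) {P : Finset (Fin K)} (hP : P.Nonempty) :
    (Finset.univ.filter fun v => batch v = P).card ≤ h * (s / h.choose r) := by
  obtain ⟨l, hl⟩ := hP
  have hopposite : ∀ k, P ∈ (machineHalf side (!side k)).powersetCard r → side k = !side l := by
    intro k hk
    have hlk := (Finset.mem_powersetCard.1 hk).1 hl
    rw [machineHalf, Finset.mem_filter] at hlk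
    rw [hlk.2, Bool.not_not]
  have hhalf : (Finset.univ.filter fun k => side k = !side l).card = h := hside (!side l)
  rw [hb.card_batch_eq, ← hhalf, ← smul_eq_mul, ← Finset.sum_const, Finset.sum_filter, hhalf]
  refine Finset.sum_le_sum fun k _ => ?_
  rw [batchSize, hside, if_neg (Finset.ne_empty_of_mem hl), add_zero]
  split_ifs with hk hkl
  exacts [le_rfl, (hkl (hopposite k hk)).elim, Nat.zero_le _, le_rfl]

theorem card_mem_batch_le (hb : IsBatching side r s σ ρ batch) (hr : 1 ≤ r)
    (hside : ∀ a, (machineHalf side a).card = h) (k : Fin K) :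
    (Finset.univ.filter fun v => k ∈ batch v).card ≤
      h * (s / h.choose r) * (h - 1).choose (r - 1) := by
  have hsubsets := Finset.card_filter_powersetCard_subset {k} (machineHalf side (side k)) r
    (by simp [machineHalf]) (by simpa using hr)
  rw [hside, Finset.card_singleton] at hsubsets
  rw [← hsubsets]
  refine Finset.card_le_mul_card_image_of_maps_to (f := batch) (fun v hv => ?_) _ fun P hP => ?_
  · have hkv : k ∈ batch v := (Finset.mem_filter.1 hv).2
    have hmem := (hb.batch_mem v).resolve_right (Finset.ne_empty_of_mem hkv)
    have hkσ : side k = !σ v := by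
      simpa [machineHalf] using (Finset.mem_powersetCard.1 hmem).1 hkv
    simpa [hkσ, hkv] using hmem
  · have hkP : k ∈ P := by simpa using (Finset.mem_filter.1 hP).2
    exact (Finset.card_le_card (Finset.filter_subset_filter _ (Finset.subset_univ _))).trans
      (hb.card_batch_eq_le hside ⟨k, hkP⟩)

theorem card_load_le (hb : IsBatching side r s σ ρ batch) (hr : 1 ≤ r)
    (hside : ∀ a, (machineHalf side a).card = h) (k : Fin K) :
    (Finset.univ.filter fun v => k ∈ batch v ∨ batch v = ∅ ∧ ρ v = k).card ≤ r * s := by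
  have hrest : (Finset.univ.filter fun v => batch v = ∅ ∧ ρ v = k).card = s % h.choose r := by
    simp_rw [and_comm (a := batch _ = ∅)]
    simp [hb.card_eq, batchSize, hside, (Nat.one_le_iff_ne_zero.1 hr).symm]
  classical
  rw [Finset.filter_or]
  refine (Finset.card_union_le _ _).trans
    ((Nat.add_le_add (hb.card_mem_batch_le hr hside k) hrest.le).trans ?_)
  have hpos : 0 < h := by rw [← hside (side k), Finset.card_pos]; exact ⟨k, by simp [machineHalf]⟩
  have hchoose : h * (h - 1).choose (r - 1) = h.choose r * r := by
    simpa [Nat.sub_add_cancel hr, Nat.sub_add_cancel hpos] using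
      Nat.add_one_mul_choose_eq (h - 1) (r - 1)
  calc h * (s / h.choose r) * (h - 1).choose (r - 1) + s % h.choose r
      = r * (h.choose r * (s / h.choose r)) + s % h.choose r := by
        rw [mul_right_comm, hchoose]; ring
    _ ≤ r * (h.choose r * (s / h.choose r)) + r * (s % h.choose r) := by
        gcongr
        exact Nat.le_mul_of_pos_left _ hr
    _ = r * s := by rw [← mul_add, Nat.div_add_mod]

theorem exists_allocation (hb : IsBatching side r s σ ρ batch) (hr : 1 ≤ r) (hrK : r ≤ K)
    (hside : ∀ a, (machineHalf side a).card = h) (hs : Fintype.card V = K * s) :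
    ∃ A : Allocation V K r, A.reducer = ρ ∧ ∀ v, batch v ⊆ A.mappers v := by
  have hcover : ∀ v, ∃ k, v ∈ Finset.univ.filter fun v => k ∈ batch v ∨ batch v = ∅ ∧ ρ v = k := by
    intro v
    rcases (batch v).eq_empty_or_nonempty with hv | ⟨k, hk⟩
    · exact ⟨ρ v, by simp [hv]⟩
    · exact ⟨k, by simp [hk]⟩
  obtain ⟨A, hA, hload⟩ := exists_allocation_of_cover hrK hs ρ hb.card_reducer_eq _ hcover
    (hb.card_load_le hr hside)
  exact ⟨A, hA, fun v k hk => Allocation.mem_mappers.2 (hload k (by simp [hk]))⟩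

end IsBatching

/-- The groups of `r + 1` machines of one half, inside which the values are coded. -/
def machineGroups (side : Fin K → Bool) (r : ℕ) : Finset (Finset (Fin K)) :=
  Finset.univ.biUnion fun a => (machineHalf side a).powersetCard (r + 1)

theorem card_machineGroups_le {side : Fin K → Bool} (hside : ∀ a, (machineHalf side a).card = h) :
    (machineGroups side r).card ≤ 2 * h.choose (r + 1) :=
  Finset.card_biUnion_le.trans_eq (by simp [hside])

theorem card_of_mem_machineGroups {side : Fin K → Bool} {S : Finset (Fin K)}
    (hS : S ∈ machineGroups side r) : S.card = r + 1 := by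
  obtain ⟨a, -, ha⟩ := Finset.mem_biUnion.1 hS
  exact (Finset.mem_powersetCard.1 ha).2

open scoped Classical in
/-- The pairs whose values are sent uncoded, for a colouring `col` of the graph that `σ` balances:
one of the vertices has been recoloured, or the second one is in the batch `∅`. -/
noncomputable def uncodedPairs (col σ : V → Bool) (batch : V → Finset (Fin K)) : Finset (V × V) :=
  {p | σ p.1 ≠ col p.1 ∨ σ p.2 ≠ col p.2 ∨ batch p.2 = ∅}

theorem card_uncodedPairs_le (col σ : V → Bool) (batch : V → Finset (Fin K)) :
    (uncodedPairs col σ batch).card ≤ Fintype.card V *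
      (2 * (Finset.univ.filter fun v => σ v ≠ col v).card +
        (Finset.univ.filter fun v => batch v = ∅).card) := by
  classical
  set M := Finset.univ.filter fun v => σ v ≠ col v
  set E := Finset.univ.filter fun v => batch v = ∅
  have hsub : uncodedPairs col σ batch ⊆ M ×ˢ Finset.univ ∪ Finset.univ ×ˢ (M ∪ E) := by
    intro p hp
    simpa [M, E, uncodedPairs] using hp
  calc (uncodedPairs col σ batch).card
      ≤ (M ×ˢ Finset.univ).card + (Finset.univ ×ˢ (M ∪ E)).card :=
        (Finset.card_le_card hsub).trans (Finset.card_union_le _ _)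
    _ ≤ M.card * Fintype.card V + Fintype.card V * (M.card + E.card) := by
        rw [Finset.card_product, Finset.card_product, Finset.card_univ]
        gcongr
        exact Finset.card_union_le _ _
    _ = _ := by ring

/-- The largest number of values that a machine of the group `S` lacks while all other machines of
`S` know them. -/
noncomputable def groupLoad (G : SimpleGraph V) (A : Allocation V K r)
    (batch : V → Finset (Fin K)) (S : Finset (Fin K)) : ℕ :=
  S.sup fun k => adjCount G (A.groupPairs batch S k)

namespace IsBatching

variable {side : Fin K → Bool} {σ : V → Bool} {batch : V → Finset (Fin K)} {A : Allocation V K r}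

theorem insert_mem_machineGroups (hb : IsBatching side r s σ A.reducer batch) {i j : V}
    (hij : σ i = !σ j) (hj : batch j ≠ ∅) (hnot : A.reducer i ∉ batch j) :
    insert (A.reducer i) (batch j) ∈ machineGroups side r := by
  obtain ⟨hsub, hcard⟩ := Finset.mem_powersetCard.1 ((hb.batch_mem j).resolve_right hj)
  refine Finset.mem_biUnion.2 ⟨!σ j, Finset.mem_univ _, Finset.mem_powersetCard.2
    ⟨Finset.insert_subset ?_ hsub, by rw [Finset.card_insert_of_notMem hnot, hcard]⟩⟩
  simp [machineHalf, hb.side_reducer, hij]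

theorem card_groupPairs_le (hb : IsBatching side r s σ A.reducer batch) (hr : 1 ≤ r)
    (hside : ∀ a, (machineHalf side a).card = h) {S : Finset (Fin K)}
    (hS : S ∈ machineGroups side r) {k : Fin K} (hk : k ∈ S) :
    (A.groupPairs batch S k).card ≤ s * (h * (s / h.choose r)) := by
  have hproduct : A.groupPairs batch S k = (Finset.univ.filter fun v => A.reducer v = k) ×ˢ
      (Finset.univ.filter fun v => batch v = S.erase k) := by
    ext
    simp [Allocation.groupPairs]
  have hne : (S.erase k).Nonempty := by
    rw [← Finset.card_pos, Finset.card_erase_of_mem hk, card_of_mem_machineGroups hS]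
    omega
  rw [hproduct, Finset.card_product, hb.card_reducer_eq]
  exact Nat.mul_le_mul_left s (hb.card_batch_eq_le hside hne)

theorem minBits_le (hb : IsBatching side r s σ A.reducer batch)
    (hmap : ∀ v, batch v ⊆ A.mappers v) (hr : 1 ≤ r) {G : SimpleGraph V} {col : V → Bool}
    (hcol : ∀ i j, G.Adj i j → col i ≠ col j) (T : ℕ) :
    minBits G A T ≤ adjCount G (uncodedPairs col σ batch) * T +
      (r + 1) * ∑ S ∈ machineGroups side r, (groupLoad G A batch S * T / r + 1) := by
  refine minBits_le_coded hmap (fun S => card_of_mem_machineGroups) (fun p hp hU => ?_)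
    fun S _ k hk => ?_
  · obtain ⟨hadj, hred⟩ := Allocation.mem_missing.1 hp
    simp only [uncodedPairs, Finset.mem_filter, Finset.mem_univ, true_and, not_or, not_not] at hU
    refine hb.insert_mem_machineGroups ?_ hU.2.2 fun h => hred (hmap _ h)
    rw [hU.1, hU.2.1]
    exact Bool.eq_not.2 (hcol _ _ hadj)
  · have hsup : adjCount G (A.groupPairs batch S k) ≤ groupLoad G A batch S :=
      Finset.le_sup (f := fun k => adjCount G (A.groupPairs batch S k)) hk
    exact (Nat.mul_le_mul_right T hsup).trans (Nat.lt_mul_div_succ _ hr).le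

theorem minBits_div_le (hb : IsBatching side r s σ A.reducer batch)
    (hmap : ∀ v, batch v ⊆ A.mappers v) (hr : 1 ≤ r) {G : SimpleGraph V} {col : V → Bool}
    (hcol : ∀ i j, G.Adj i j → col i ≠ col j) {T : ℕ} (hT : 0 < T) :
    (minBits G A T : ℝ) / T ≤ adjCount G (uncodedPairs col σ batch) +
      (r + 1) * ∑ S ∈ machineGroups side r, ((groupLoad G A batch S : ℝ) / r + 1) := by
  have hT' : (1 : ℝ) ≤ T := by exact_mod_cast hT
  have hfloor : ∀ S, ((groupLoad G A batch S * T / r + 1 : ℕ) : ℝ) ≤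
      ((groupLoad G A batch S : ℝ) / r + 1) * T := by
    intro S
    have h := Nat.cast_div_le (α := ℝ) (m := groupLoad G A batch S * T) (n := r)
    push_cast at h ⊢
    rw [mul_div_right_comm] at h
    linarith
  have hbits : (minBits G A T : ℝ) ≤ adjCount G (uncodedPairs col σ batch) * T +
      (r + 1) * ∑ S ∈ machineGroups side r, ((groupLoad G A batch S * T / r + 1 : ℕ) : ℝ) := by
    exact_mod_cast hb.minBits_le hmap hr hcol T
  rw [div_le_iff₀ (by linarith), add_mul, mul_assoc, Finset.sum_mul]
  refine hbits.trans ?_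
  gcongr with S
  exact hfloor S

end IsBatching

end Batching

section Achievability

open scoped Classical in
theorem exists_balanced_coloring {V : Type*} [Fintype V] (col : V → Bool) {N : ℕ}
    (hN : Fintype.card V = 2 * N) :
    ∃ σ : V → Bool, (∀ a, (Finset.univ.filter fun v => σ v = a).card = N) ∧
      (Finset.univ.filter fun v => σ v ≠ col v).card =
        |((Finset.univ.filter fun v => col v = true).card : ℤ) - N| := by
  set t := Finset.univ.filter fun v => col v = true
  obtain ⟨u, hu, hut⟩ : ∃ u : Finset V, u.card = N ∧ (u ⊆ t ∨ t ⊆ u) := by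
    rcases le_total N t.card with h | h
    · obtain ⟨u, hut, hu⟩ := Finset.exists_subset_card_eq h
      exact ⟨u, hu, Or.inl hut⟩
    · obtain ⟨u, hut, hu⟩ := Finset.exists_superset_card_eq h (by omega)
      exact ⟨u, hu, Or.inr hut⟩
  refine ⟨fun v => decide (v ∈ u), fun a => ?_, ?_⟩
  · cases a
    · have := u.card_compl
      simp [← Finset.compl_filter]
      omega
    · simpa using hu
  · have hdiff : (Finset.univ.filter fun v => decide (v ∈ u) ≠ col v) = (u \ t) ∪ (t \ u) := by
      ext v
      by_cases v ∈ u <;> simp [t, *]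
    rw [hdiff]
    rcases hut with h | h
    · rw [Finset.sdiff_eq_empty_iff_subset.2 h, Finset.empty_union, Finset.card_sdiff_of_subset h]
      have := Finset.card_le_card h
      rw [abs_of_nonneg] <;> omega
    · rw [Finset.sdiff_eq_empty_iff_subset.2 h, Finset.union_empty, Finset.card_sdiff_of_subset h]
      have := Finset.card_le_card h
      rw [abs_of_nonpos] <;> omega

theorem exists_balanced_coloring_sum {n₁ n₂ N : ℕ} (hN : n₁ + n₂ = 2 * N) :
    ∃ σ : Fin n₁ ⊕ Fin n₂ → Bool, (∀ a, (Finset.univ.filter fun v => σ v = a).card = N) ∧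
      2 * ((Finset.univ.filter fun v => σ v ≠ v.isRight).card : ℝ) = |(n₁ : ℝ) - n₂| := by
  classical
  obtain ⟨σ, hσ, hcol⟩ := exists_balanced_coloring (V := Fin n₁ ⊕ Fin n₂) Sum.isRight (by simpa)
  refine ⟨σ, hσ, ?_⟩
  have hright : (Finset.univ.filter fun v : Fin n₁ ⊕ Fin n₂ => v.isRight = true).card = n₂ := by
    simp [Finset.card_filter, Fintype.sum_sum_type, -Finset.sum_boole]
  have hN' : (n₁ : ℝ) + n₂ = 2 * N := by exact_mod_cast hN
  rw [hright] at hcol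
  have hcol' : ((Finset.univ.filter fun v => σ v ≠ v.isRight).card : ℝ) = |(n₂ : ℝ) - N| := by
    exact_mod_cast congrArg (Int.cast (R := ℝ)) hcol
  rw [hcol', abs_sub_comm (n₁ : ℝ), show (n₂ : ℝ) - n₁ = 2 * (n₂ - N) by linarith, abs_mul, abs_two]

theorem isRight_ne_of_bipartiteGraph_adj {n₁ n₂ : ℕ} {E : Set (Fin n₁ × Fin n₂)}
    {i j : Fin n₁ ⊕ Fin n₂} (hij : (bipartiteGraph E).Adj i j) : i.isRight ≠ j.isRight := by
  obtain ⟨e, -, ⟨rfl, rfl⟩ | ⟨rfl, rfl⟩⟩ := hij <;> simp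

variable {n₁ n₂ K r h s : ℕ}

theorem two_mul_pairs_le (h r s : ℕ) : 2 * (s * (h * (s / h.choose r))) ≤ (2 * h * s) ^ 2 := by
  calc 2 * (s * (h * (s / h.choose r))) ≤ 2 * (s * (h * s)) := by
        gcongr
        exact Nat.div_le_self _ _
    _ = 2 * h * s ^ 2 := by ring
    _ ≤ (2 * h) ^ 2 * s ^ 2 := by
        gcongr
        exact Nat.le_self_pow two_ne_zero _
    _ = (2 * h * s) ^ 2 := by ring

namespace IsBatching

variable {A : Allocation (Fin n₁ ⊕ Fin n₂) K r} {side : Fin K → Bool} {σ : Fin n₁ ⊕ Fin n₂ → Bool}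
  {batch : Fin n₁ ⊕ Fin n₂ → Finset (Fin K)}

theorem integral_groupLoad_le (hb : IsBatching side r s σ A.reducer batch) (hr : 1 ≤ r)
    (hside : ∀ a, (machineHalf side a).card = h) {S : Finset (Fin K)}
    (hS : S ∈ machineGroups side r) (q : unitInterval) :
    ∫ E : Set (Fin n₁ × Fin n₂), (groupLoad (bipartiteGraph E) A batch S : ℝ)
        ∂(setBernoulli Set.univ q) ≤
      q * ((s * (h * (s / h.choose r)) : ℕ) : ℝ) +
        (r + 1) * (2 * h * s * √q) := by
  set N := s * (h * (s / h.choose r))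
  have hpairs : ∀ k ∈ S, (q : ℝ) * (A.groupPairs batch S k).card ≤ q * N := fun k hk =>
    mul_le_mul_of_nonneg_left (by exact_mod_cast hb.card_groupPairs_le hr hside hS hk) q.2.1
  have hvar : 2 * (q * (N : ℝ)) ≤ (2 * h * s) ^ 2 * q := by
    have htwo : 2 * (N : ℝ) ≤ (2 * h * s) ^ 2 := by exact_mod_cast two_mul_pairs_le h r s
    nlinarith [mul_le_mul_of_nonneg_right htwo q.2.1]
  have hcard : (r : ℝ) + 1 = S.card := by exact_mod_cast (card_of_mem_machineGroups hS).symm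
  have hne : S.Nonempty := Finset.card_pos.1 (by rw [card_of_mem_machineGroups hS]; omega)
  rw [hcard, ← Real.sqrt_sq (show (0 : ℝ) ≤ 2 * h * s by positivity),
    ← Real.sqrt_mul (by positivity)]
  refine integral_le_add_card_mul_sqrt
    (X := fun k E => (adjCount (bipartiteGraph E) (A.groupPairs batch S k) : ℝ))
    (fun k _ => .of_discrete) .of_finite (fun E => ?_)
    (fun k hk => (integral_adjCount_bipartiteGraph_le q _).trans (hpairs k hk))
    fun k hk => (variance_adjCount_bipartiteGraph_le q _).trans ?_
  · obtain ⟨k, hk, hmax⟩ := Finset.exists_mem_eq_sup S hne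
      fun k => adjCount (bipartiteGraph E) (A.groupPairs batch S k)
    exact ⟨k, hk, by exact_mod_cast hmax.le⟩
  · exact (mul_le_mul_of_nonneg_left (hpairs k hk) zero_le_two).trans hvar

theorem integral_minBits_div_le (hb : IsBatching side r s σ A.reducer batch)
    (hmap : ∀ v, batch v ⊆ A.mappers v) (hr : 1 ≤ r)
    (hside : ∀ a, (machineHalf side a).card = h) {T : ℕ} (hT : 0 < T) (q : unitInterval) {b : ℝ}
    (hload : ∀ S ∈ machineGroups side r, ∫ E : Set (Fin n₁ × Fin n₂),
      (groupLoad (bipartiteGraph E) A batch S : ℝ) ∂(setBernoulli Set.univ q) ≤ b) (hb0 : 0 ≤ b) :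
    ∫ E : Set (Fin n₁ × Fin n₂), (minBits (bipartiteGraph E) A T : ℝ) / T
        ∂(setBernoulli Set.univ q) ≤
      q * (uncodedPairs Sum.isRight σ batch).card +
        (r + 1) * (2 * h.choose (r + 1)) * (b / r + 1) := by
  have hgroups : ((machineGroups side r).card : ℝ) ≤ 2 * h.choose (r + 1) := by
    exact_mod_cast card_machineGroups_le (r := r) hside
  calc ∫ E : Set (Fin n₁ × Fin n₂), (minBits (bipartiteGraph E) A T : ℝ) / T
        ∂(setBernoulli Set.univ q)
      ≤ ∫ E : Set (Fin n₁ × Fin n₂),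
          (adjCount (bipartiteGraph E) (uncodedPairs Sum.isRight σ batch) + (r + 1) *
            ∑ S ∈ machineGroups side r, ((groupLoad (bipartiteGraph E) A batch S : ℝ) / r + 1))
          ∂(setBernoulli Set.univ q) :=
        integral_mono .of_finite .of_finite fun E =>
          hb.minBits_div_le hmap hr (fun _ _ => isRight_ne_of_bipartiteGraph_adj) hT
    _ ≤ q * (uncodedPairs Sum.isRight σ batch).card +
          (r + 1) * ∑ S ∈ machineGroups side r, (b / r + 1) := by
        rw [integral_add .of_finite .of_finite, integral_const_mul,
          integral_finsetSum _ fun _ _ => .of_finite]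
        gcongr with S hS
        · exact integral_adjCount_bipartiteGraph_le q _
        · rw [integral_add .of_finite .of_finite, integral_div, integral_const, probReal_univ,
            one_smul]
          gcongr
          exact hload S hS
    _ ≤ _ := by
        rw [Finset.sum_const, nsmul_eq_mul, mul_assoc ((r : ℝ) + 1)]
        gcongr

end IsBatching

theorem groups_mul_pairs_le (h r s : ℕ) :
    (r + 1) * (2 * h.choose (r + 1)) * (s * (h * (s / h.choose r))) ≤
      2 * h * (h - r) * s ^ 2 := by
  calc (r + 1) * (2 * h.choose (r + 1)) * (s * (h * (s / h.choose r)))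
      = 2 * (h.choose (r + 1) * (r + 1)) * h * s * (s / h.choose r) := by ring
    _ = 2 * h * (h - r) * s * (h.choose r * (s / h.choose r)) := by
        rw [Nat.choose_succ_right_eq]; ring
    _ ≤ 2 * h * (h - r) * s * s := by gcongr; exact Nat.mul_div_le _ _
    _ = 2 * h * (h - r) * s ^ 2 := by ring

theorem groups_mul_load_le {q x : ℝ} (hq : 0 ≤ q) (hx : 0 ≤ x) (hr : 1 ≤ r) (hrh : r ≤ h) :
    (r + 1) * (2 * h.choose (r + 1)) *
        ((q * ((s * (h * (s / h.choose r)) : ℕ) : ℝ) + (r + 1) * x) / r + 1) ≤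
      q * (1 / (2 * r) * (1 - 2 * r / ((2 * h : ℕ) : ℝ))) * (2 * h * s) ^ 2 +
        (r + 1) ^ 2 * (2 * h.choose (r + 1)) * (x + 1) := by
  have hmain : (r + 1) * (2 * h.choose (r + 1)) * ((s * (h * (s / h.choose r)) : ℕ) : ℝ) ≤
      2 * h * (h - r) * s ^ 2 := by
    rw [← Nat.cast_sub hrh]
    exact_mod_cast groups_mul_pairs_le h r s
  have hr' : (1 : ℝ) ≤ r := by exact_mod_cast hr
  have herror : (r + 1) * x / r + 1 ≤ (r + 1) * (x + 1) := by
    have := div_le_self (show 0 ≤ (r + 1) * x by positivity) hr'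
    linarith
  calc _ = q / r * ((r + 1) * (2 * h.choose (r + 1)) * ((s * (h * (s / h.choose r)) : ℕ) : ℝ)) +
        (r + 1) * (2 * h.choose (r + 1)) * ((r + 1) * x / r + 1) := by ring
    _ ≤ q / r * (2 * h * (h - r) * s ^ 2) +
        (r + 1) * (2 * h.choose (r + 1)) * ((r + 1) * (x + 1)) := by gcongr
    _ = _ := by
        have hh : (h : ℝ) ≠ 0 := by exact_mod_cast (show 0 < h by omega).ne'
        push_cast
        field_simp

theorem exists_integral_commLoad_le {T : ℕ} (q : unitInterval) (hT : 0 < T) (hr : 1 ≤ r)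
    (hrh : r ≤ h) (hs : 0 < s) (hn : n₁ + n₂ = 2 * h * s) :
    ∃ A : Allocation (Fin n₁ ⊕ Fin n₂) (2 * h) r,
      ∫ E : Set (Fin n₁ × Fin n₂), commLoad (bipartiteGraph E) A T ∂(setBernoulli Set.univ q) ≤
        q * (1 / (2 * r) * (1 - 2 * r / ((2 * h : ℕ) : ℝ)) +
          |(n₁ : ℝ) - n₂| / ((n₁ + n₂ : ℕ) : ℝ) +
            (2 * h * h.choose r : ℕ) / ((n₁ + n₂ : ℕ) : ℝ)) +
        (r + 1) ^ 2 * (2 * h.choose (r + 1)) *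
          (√q / ((n₁ + n₂ : ℕ) : ℝ) + 1 / ((n₁ + n₂ : ℕ) : ℝ) ^ 2) := by
  obtain ⟨σ, hσ, hrecolored⟩ := exists_balanced_coloring_sum (hn.trans (mul_assoc 2 h s))
  obtain ⟨side, hside⟩ := exists_map_of_card_eq_mul (V := Fin (2 * h)) (β := Bool) (s := h)
    (by simp)
  obtain ⟨ρ, batch, hb⟩ := exists_isBatching (r := r) hside hσ
  obtain ⟨A, rfl, hmap⟩ := hb.exists_allocation hr (by omega) hside (by simpa using hn)
  refine ⟨A, ?_⟩
  have hbits := (hb.integral_minBits_div_le hmap hr hside hT q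
    (fun S hS => hb.integral_groupLoad_le hr hside hS q)
    (add_nonneg (mul_nonneg q.2.1 (Nat.cast_nonneg _)) (by positivity))).trans
    (add_le_add_right (groups_mul_load_le q.2.1 (by positivity) hr hrh) _)
  have huncoded : ((uncodedPairs Sum.isRight σ batch).card : ℝ) ≤
      ((n₁ + n₂ : ℕ) : ℝ) * (|(n₁ : ℝ) - n₂| + (2 * h * h.choose r : ℕ)) := by
    rw [← hrecolored]
    have := (card_uncodedPairs_le Sum.isRight σ batch).trans
      (Nat.mul_le_mul_left _ (Nat.add_le_add_left (hb.card_batch_eq_empty_le hr hrh hside) _))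
    simp only [Fintype.card_sum, Fintype.card_fin] at this
    exact_mod_cast this
  have hn0 : (0 : ℝ) < ((n₁ + n₂ : ℕ) : ℝ) := by
    rw [hn]; have := hr.trans hrh; positivity
  have hn' : (2 * h * s : ℝ) = ((n₁ + n₂ : ℕ) : ℝ) := by rw [hn]; push_cast; ring
  rw [hn'] at hbits
  set n := ((n₁ + n₂ : ℕ) : ℝ)
  calc ∫ E : Set (Fin n₁ × Fin n₂), commLoad (bipartiteGraph E) A T ∂(setBernoulli Set.univ q)
      = (∫ E : Set (Fin n₁ × Fin n₂), (minBits (bipartiteGraph E) A T : ℝ) / T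
          ∂(setBernoulli Set.univ q)) / n ^ 2 := by
        rw [← integral_div]
        simp [commLoad, n, div_div, mul_comm]
    _ ≤ (q * (n * (|(n₁ : ℝ) - n₂| + (2 * h * h.choose r : ℕ))) +
          (q * (1 / (2 * r) * (1 - 2 * r / ((2 * h : ℕ) : ℝ))) * n ^ 2 +
            (r + 1) ^ 2 * (2 * h.choose (r + 1)) * (n * √q + 1))) / n ^ 2 := by
        gcongr
        refine hbits.trans ?_
        gcongr
        exact q.2.1
    _ = _ := by
        field_simp
        ring

end Achievability

section OptimalLoad

variable {n₁ n₂ K r h T : ℕ}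

theorem integral_commLoad_nonneg (q : unitInterval) (A : Allocation (Fin n₁ ⊕ Fin n₂) K r) :
    0 ≤ ∫ E : Set (Fin n₁ × Fin n₂), commLoad (bipartiteGraph E) A T
      ∂(setBernoulli Set.univ q) :=
  integral_nonneg fun _ => by unfold commLoad; positivity

theorem le_optimalLoad_div {q : unitInterval} (hq : 0 < q) (hT : 0 < T) (hr : 1 ≤ r)
    (hrK : r ≤ K) (hn : 0 < n₁ + n₂) (hdvd : K ∣ n₁ + n₂) :
    1 / (8 * r) * (1 - 2 * r / K - 2 * (|(n₁ : ℝ) - n₂| / ((n₁ + n₂ : ℕ) : ℝ))) ≤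
      optimalLoad n₁ n₂ K r T q / q := by
  have : Nonempty (Allocation (Fin n₁ ⊕ Fin n₂) K r) :=
    nonempty_allocation hr hrK (by simpa using hdvd)
  rw [le_div_iff₀ (show (0 : ℝ) < q from hq), mul_comm]
  exact le_ciInf fun A => le_integral_commLoad q hT hr (hr.trans hrK) hn A

theorem optimalLoad_div_le {q : unitInterval} (hq : 0 < q) (hT : 0 < T) (hr : 1 ≤ r)
    (hrh : r ≤ h) (hn : 0 < n₁ + n₂) (hdvd : 2 * h ∣ n₁ + n₂) :
    optimalLoad n₁ n₂ (2 * h) r T q / q ≤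
      1 / (2 * r) * (1 - 2 * r / ((2 * h : ℕ) : ℝ)) + |(n₁ : ℝ) - n₂| / ((n₁ + n₂ : ℕ) : ℝ) +
        (2 * h * h.choose r : ℕ) / ((n₁ + n₂ : ℕ) : ℝ) +
      (r + 1) ^ 2 * (2 * h.choose (r + 1)) *
        (√(1 / ((n₁ + n₂ : ℕ) : ℝ) ^ 2 / q) + 1 / ((n₁ + n₂ : ℕ) : ℝ) ^ 2 / q) := by
  obtain ⟨s, hs⟩ := hdvd
  obtain ⟨A, hA⟩ := exists_integral_commLoad_le q hT hr hrh
    (Nat.pos_of_mul_pos_left (hs ▸ hn)) hs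
  have hbdd : BddBelow (Set.range fun A : Allocation (Fin n₁ ⊕ Fin n₂) (2 * h) r =>
      ∫ E : Set (Fin n₁ × Fin n₂), commLoad (bipartiteGraph E) A T
        ∂(setBernoulli Set.univ q)) :=
    ⟨0, Set.forall_mem_range.2 fun A => integral_commLoad_nonneg q A⟩
  have hq' : (0 : ℝ) < q := hq
  have hn' : (0 : ℝ) < ((n₁ + n₂ : ℕ) : ℝ) := by exact_mod_cast hn
  have hsqrt : √(1 / ((n₁ + n₂ : ℕ) : ℝ) ^ 2 / q) = √q / ((n₁ + n₂ : ℕ) : ℝ) / q := by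
    rw [Real.sqrt_div (by positivity), Real.sqrt_div zero_le_one, Real.sqrt_one,
      Real.sqrt_sq hn'.le, div_right_comm (√(q : ℝ)), Real.sqrt_div_self', div_right_comm]
  refine (div_le_div_of_nonneg_right ((ciInf_le hbdd A).trans hA) hq'.le).trans_eq ?_
  rw [hsqrt]
  field_simp

variable {ι : Type*} {l : Filter ι} [l.NeBot] {n₁ n₂ T : ι → ℕ} {q : ι → unitInterval}

theorem le_liminf_optimalLoad_div (hr : 1 ≤ r) (hrK : r ≤ K) (hT : ∀ m, 0 < T m)
    (hq : ∀ m, 0 < q m) (hn : Tendsto (fun m => n₁ m + n₂ m) l atTop)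
    (hdvd : ∀ m, K ∣ n₁ m + n₂ m)
    (hdiff : (fun m => |(n₁ m : ℝ) - n₂ m|) =o[l] fun m => ((n₁ m + n₂ m : ℕ) : ℝ)) :
    ((1 / (8 * r) * (1 - 2 * r / K) : ℝ) : EReal) ≤
      liminf (fun m => ((optimalLoad (n₁ m) (n₂ m) K r (T m) (q m) / q m : ℝ) : EReal)) l := by
  have hbound : Tendsto (fun m => 1 / (8 * r) * (1 - 2 * r / K -
      2 * (|(n₁ m : ℝ) - n₂ m| / ((n₁ m + n₂ m : ℕ) : ℝ)))) l
      (nhds (1 / (8 * r) * (1 - 2 * r / K))) := by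
    simpa using ((hdiff.tendsto_div_nhds_zero.const_mul 2).const_sub
      (1 - 2 * r / K : ℝ)).const_mul (1 / (8 * r) : ℝ)
  rw [← ((continuous_coe_real_ereal.tendsto _).comp hbound).liminf_eq]
  refine liminf_le_liminf ?_
  filter_upwards [hn.eventually_gt_atTop 0] with m hm
  exact EReal.coe_le_coe_iff.2 (le_optimalLoad_div (hq m) (hT m) hr hrK hm (hdvd m))

theorem limsup_optimalLoad_div_le (hr : 1 ≤ r) (hrh : r ≤ h) (hT : ∀ m, 0 < T m)
    (hq : ∀ m, 0 < q m) (hn : Tendsto (fun m => n₁ m + n₂ m) l atTop)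
    (hdvd : ∀ m, 2 * h ∣ n₁ m + n₂ m)
    (hdiff : (fun m => |(n₁ m : ℝ) - n₂ m|) =o[l] fun m => ((n₁ m + n₂ m : ℕ) : ℝ))
    (hqω : (fun m => 1 / ((n₁ m + n₂ m : ℕ) : ℝ) ^ 2) =o[l] fun m => (q m : ℝ)) :
    limsup (fun m => ((optimalLoad (n₁ m) (n₂ m) (2 * h) r (T m) (q m) / q m : ℝ) : EReal)) l ≤
      ((1 / (2 * r) * (1 - 2 * r / ((2 * h : ℕ) : ℝ)) : ℝ) : EReal) := by
  have hω := hqω.tendsto_div_nhds_zero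
  have hsqrt : Tendsto (fun m => √(1 / ((n₁ m + n₂ m : ℕ) : ℝ) ^ 2 / q m)) l (nhds 0) := by
    simpa using hω.sqrt
  have hleftover : Tendsto (fun m => ((2 * h * h.choose r : ℕ) : ℝ) / ((n₁ m + n₂ m : ℕ) : ℝ)) l
      (nhds 0) := (tendsto_natCast_atTop_atTop.comp hn).const_div_atTop _
  have hbound : Tendsto (fun m => 1 / (2 * r) * (1 - 2 * r / ((2 * h : ℕ) : ℝ)) +
      |(n₁ m : ℝ) - n₂ m| / ((n₁ m + n₂ m : ℕ) : ℝ) +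
      (2 * h * h.choose r : ℕ) / ((n₁ m + n₂ m : ℕ) : ℝ) +
      (r + 1) ^ 2 * (2 * h.choose (r + 1)) * (√(1 / ((n₁ m + n₂ m : ℕ) : ℝ) ^ 2 / q m) +
        1 / ((n₁ m + n₂ m : ℕ) : ℝ) ^ 2 / q m)) l
      (nhds (1 / (2 * r) * (1 - 2 * r / ((2 * h : ℕ) : ℝ)))) := by
    simpa only [add_zero, mul_zero] using
      ((hdiff.tendsto_div_nhds_zero.const_add _).add hleftover).add ((hsqrt.add hω).const_mul _)
  rw [← ((continuous_coe_real_ereal.tendsto _).comp hbound).limsup_eq]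
  refine limsup_le_limsup ?_
  filter_upwards [hn.eventually_gt_atTop 0] with m hm
  exact EReal.coe_le_coe_iff.2 (optimalLoad_div_le (hq m) (hT m) hr hrh hm (hdvd m))

end OptimalLoad

theorem theorem2_general {ι : Type*} {l : Filter ι} [l.NeBot] {K r : ℕ} (hr : 1 ≤ r) (hrK : r ≤ K)
    {n₁ n₂ T : ι → ℕ} {q : ι → unitInterval} (hT : ∀ m, 0 < T m) (hq : ∀ m, 0 < q m)
    (hn : Tendsto (fun m => n₁ m + n₂ m) l atTop) (hdvd : ∀ m, K ∣ n₁ m + n₂ m)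
    (hdiff : (fun m => |(n₁ m : ℝ) - n₂ m|) =o[l] fun m => ((n₁ m + n₂ m : ℕ) : ℝ)) :
    ((1 / (8 * r) * (1 - 2 * r / K) : ℝ) : EReal) ≤
        liminf (fun m => ((optimalLoad (n₁ m) (n₂ m) K r (T m) (q m) / q m : ℝ) : EReal)) l ∧
      (Even K → 2 * r ≤ K →
        (fun m => 1 / ((n₁ m + n₂ m : ℕ) : ℝ) ^ 2) =o[l] (fun m => (q m : ℝ)) →
        limsup (fun m => ((optimalLoad (n₁ m) (n₂ m) K r (T m) (q m) / q m : ℝ) : EReal)) l ≤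
          ((1 / (2 * r) * (1 - 2 * r / K) : ℝ) : EReal)) := by
  refine ⟨le_liminf_optimalLoad_div hr hrK hT hq hn hdvd hdiff, fun hK hrh hqω => ?_⟩
  obtain ⟨h, rfl⟩ := even_iff_exists_two_mul.1 hK
  exact limsup_optimalLoad_div_le hr (by omega) hT hq hn hdvd hdiff hqω

theorem theorem2 (K r : ℕ) (hr : 1 ≤ r) (hrK : r ≤ K)
    (n₁ n₂ T : ℕ → ℕ) (q : ℕ → unitInterval)
    (hT : ∀ m, 0 < T m) (hq : ∀ m, 0 < q m)
    (hn : Tendsto (fun m => n₁ m + n₂ m) atTop atTop)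
    (hdvd : ∀ m, K ∣ n₁ m + n₂ m)
    (hn₁ : (fun m => (n₁ m : ℝ)) =Θ[atTop] fun m => ((n₁ m + n₂ m : ℕ) : ℝ))
    (hn₂ : (fun m => (n₂ m : ℝ)) =Θ[atTop] fun m => ((n₁ m + n₂ m : ℕ) : ℝ))
    (hdiff : (fun m => |(n₁ m : ℝ) - n₂ m|) =o[atTop] fun m => ((n₁ m + n₂ m : ℕ) : ℝ))
    (hqω : (fun m => 1 / ((n₁ m + n₂ m : ℕ) : ℝ) ^ 2) =o[atTop] fun m => (q m : ℝ)) :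
    ((1 / (8 * r) * (1 - 2 * r / K) : ℝ) : EReal) ≤
        limsup (fun m => ((optimalLoad (n₁ m) (n₂ m) K r (T m) (q m) / q m : ℝ) : EReal)) atTop ∧
      (Even K → 2 * r ≤ K →
        limsup (fun m => ((optimalLoad (n₁ m) (n₂ m) K r (T m) (q m) / q m : ℝ) : EReal)) atTop ≤
          ((1 / (2 * r) * (1 - 2 * r / K) : ℝ) : EReal)) := by
  obtain ⟨hlower, hupper⟩ := theorem2_general hr hrK hT hq hn hdvd hdiff
  exact ⟨hlower.trans liminf_le_limsup, fun hK hrh => hupper hK hrh hqω⟩
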